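/- \textbf{Setting.} For a finite simple graph $G=(V,E)$ with $n=|V|$ and an integer $t\ge 0$, the problem \emph{Assignment Clique Cover} (ACC) asks for a set $\mathcal C$ of cliques of $G$ such that every edge of $G$ is contained in a member of $\mathcal C$ and $\sum_{C\in\mathcal C}|C|\le t$; if no such $\mathcal C$ exists, the answer is NO. The \emph{degeneracy} $d$ of $G$ is the least $d$ such that every nonempty subgraph has a vertex with at most $d$ neighbours in it. A \emph{degeneracy ordering} is an ordering $u_1,\dots,u_n$ of $V$ in which every vertex has at most $d$ later neighbours; $N_d(x)$ is the set of later neighbours of $x$, $N_d[x]=N_d(x)\cup\{x\}$, $N[y]=N(y)\cup\{y\}$. A \emph{degeneracy edge permutation} (DEP) lists, for $i=1,2,\dots$ in this order, the edges $\{u_i,y\}$ with $y\in N_d(u_i)$ (in any order for fixed $i$). The recursive procedure $\mathrm{ACCS}(G,t,\mathcal C)$, for a given degeneracy ordering, DEP, and order of enumeration of cliques, is as follows. (1) If $\mathcal C$ covers all edges, return $\mathcal C$. (2) If $t<2$, fail. (3) Let $\{x,y\}$, $y\in N_d(x)$, be the first uncovered edge of the DEP. (4) For each clique $Z$ of $G[N_d[x]\cap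 N[y]]$ containing $x$ and $y$ with $|Z|\le t$, call $\mathrm{ACCS}(G,t-|Z|,\mathcal C\cup\{Z\})$, and return its result if it succeeds. (5) Fail. Running the procedure on $(G,t)$ means calling $\mathrm{ACCS}(G,t,\emptyset)$, failure being read as NO. \textbf{Theorem.} (a) There are a program for a random access machine (unit-cost addition, truncated subtraction, indexed memory access and branching on zero) and a constant $c$ such that, for every graph $G$ on $n$ vertices, given by its adjacency matrix, and every $t\ge 0$, the program halts on $(G,t)$ after at most $1.4143^{t^2}\,(n+2)^{c}$ steps; it outputs a solution of the instance $(G,t)$ of ACC if there is one and NO otherwise; and its output is the result of $\mathrm{ACCS}(G,t,\emptyset)$ for some degeneracy ordering, some DEP and some order of enumeration of the cliques. (b) For every graph $G$ on $n$ vertices, every $t\ge0$, every degeneracy ordering, every DEP for it and every order of enumeration of the cliques, $\mathrm{ACCS}(G,t,\emptyset)$ returns a solution of $(G,t)$ if there is one and fails otherwise; its search tree has depth at most $t/2$; and if at most $t$ vertices of $G$ are non-isolated, then its search tree has at most $1.4143^{t^2}$ nodes. -/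

import Mathlib

namespace ACC

/-! ### The problem -/

section Problem

variable {V : Type*} [DecidableEq V]

/-- The vertex pair `x, y` lies together in a member of `C`. -/
def Covered (C : Finset (Finset V)) (x y : V) : Prop :=
  ∃ K ∈ C, x ∈ K ∧ y ∈ K

instance (C : Finset (Finset V)) (x y : V) : Decidable (Covered C x y) := by
  unfold Covered; infer_instance

/-- `C` is a set of cliques of `G` that covers every edge of `G` and makes at most `t`
individual assignments of vertices to cliques. -/
def IsSolution (G : SimpleGraph V) (t : ℕ) (C : Finset (Finset V)) : Prop :=
  (∀ K ∈ C, G.IsClique (K : Set V)) ∧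
  (∀ x y, G.Adj x y → Covered C x y) ∧
  ∑ K ∈ C, K.card ≤ t

/-- Correct answers to the instance `(G, t)` of Assignment Clique Cover: `some C` for a
solution `C`, and `none` (that is, NO) if there is no solution. -/
def IsAnswer (G : SimpleGraph V) (t : ℕ) : Option (Finset (Finset V)) → Prop
  | some C => IsSolution G t C
  | none => ¬ ∃ C, IsSolution G t C

end Problem

/-! ### Degeneracy, degeneracy orderings, degeneracy edge permutations -/

section Degeneracy

variable {V : Type*}

/-- The smallest `d` such that every nonempty subgraph has a vertex with at most `d`
neighbours in the subgraph. -/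
noncomputable def degeneracy (G : SimpleGraph V) : ℕ :=
  sInf {d : ℕ | ∀ H : G.Subgraph, H.verts.Nonempty → ∃ v ∈ H.verts, (H.neighborSet v).ncard ≤ d}

/-- `N_d(x)`: the neighbours of `x` that come later in the vertex ordering `σ`
(`σ v` is the position of `v`). -/
def laterNbrs {n : ℕ} (G : SimpleGraph V) (σ : V ≃ Fin n) (x : V) : Set V :=
  {y | G.Adj x y ∧ σ x < σ y}

/-- Every vertex has at most `d` neighbours that come later, where `d` is the degeneracy. -/
def IsDegeneracyOrdering {n : ℕ} (G : SimpleGraph V) (σ : V ≃ Fin n) : Prop :=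
  ∀ x, (laterNbrs G σ x).ncard ≤ degeneracy G

/-- `π` is a degeneracy edge permutation for the ordering `σ`: the concatenation, for the
vertices `x` in the order `σ`, of permutations of the edges from `x` to `N_d(x)`.
An edge is listed as `(x, y)` with `y ∈ N_d(x)`. -/
def IsDEP {n : ℕ} (G : SimpleGraph V) (σ : V ≃ Fin n) (π : List (V × V)) : Prop :=
  ∃ b : V → List V,
    (∀ x, (b x).Nodup ∧ ∀ y, y ∈ b x ↔ y ∈ laterNbrs G σ x) ∧
    π = (List.finRange n).flatMap fun i => (b (σ.symm i)).map fun y => (σ.symm i, y)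

/-- `N_d[x] ∩ N[y]`. -/
def restrictedSet {n : ℕ} (G : SimpleGraph V) (σ : V ≃ Fin n) (x y : V) : Set V :=
  insert x (laterNbrs G σ x) ∩ insert y (G.neighborSet y)

/-- For every edge `{x, y}` with `y ∈ N_d(x)`, the list `cl x y` enumerates, without
repetition, all cliques of `G[N_d[x] ∩ N[y]]` that contain `x` and `y`. -/
def EnumeratesCliques {n : ℕ} (G : SimpleGraph V) (σ : V ≃ Fin n)
    (cl : V → V → List (Finset V)) : Prop :=
  ∀ x, ∀ y ∈ laterNbrs G σ x, (cl x y).Nodup ∧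
    ∀ Z : Finset V, Z ∈ cl x y ↔
      G.IsClique (Z : Set V) ∧ x ∈ Z ∧ y ∈ Z ∧ (Z : Set V) ⊆ restrictedSet G σ x y

end Degeneracy

/-! ### The search procedure -/

section Search

variable {V : Type*} [DecidableEq V]

/-- What a call of the search returns (`none` stands for failure), with the depth (number of
edges on a longest downward path) and the number of nodes of the search tree below it. -/
structure Outcome (V : Type*) where
  result : Option (Finset (Finset V))
  depth : ℕ
  nodes : ℕ

mutual

/-- Assignment-Clique-Cover-Search with remaining budget `t` and current set of cliques `C`.
The list `π` lists the edges of the graph; the search picks the first edge of `π` that is not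
yet covered (returning `C` if there is none), fails if `t < 2`, and otherwise tries the
cliques in `cl x y` one after the other. -/
def accs (π : List (V × V)) (cl : V → V → List (Finset V)) (t : ℕ) (C : Finset (Finset V)) :
    Outcome V :=
  match π.find? (fun e => decide (¬ Covered C e.1 e.2)) with
  | none => ⟨some C, 0, 1⟩
  | some (x, y) =>
    if t < 2 then ⟨none, 0, 1⟩
    else
      let r := accsLoop π cl t C (cl x y)
      ⟨r.result, r.depth, r.nodes + 1⟩
termination_by (t, 1, 0)

/-- The loop over candidate cliques: recurse on each `Z` with `t - |Z| ≥ 0` until a recursive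
call succeeds. (The test `0 < |Z|` is there for termination only; candidates contain an
edge.) -/
def accsLoop (π : List (V × V)) (cl : V → V → List (Finset V)) (t : ℕ) (C : Finset (Finset V))
    (Zs : List (Finset V)) : Outcome V :=
  match Zs with
  | [] => ⟨none, 0, 0⟩
  | Z :: Zs =>
    if 0 < Z.card ∧ Z.card ≤ t then
      let r := accs π cl (t - Z.card) (insert Z C)
      if r.result.isSome then ⟨r.result, r.depth + 1, r.nodes⟩
      else
        let r' := accsLoop π cl t C Zs
        ⟨r'.result, max (r.depth + 1) r'.depth, r.nodes + r'.nodes⟩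
    else accsLoop π cl t C Zs
termination_by (t, 0, Zs.length)

end

end Search

/-! ### The machine model

Structured programs of a random access machine whose instruction set has addition and
(truncated) subtraction, at unit cost per operation. The memory consists of cells holding
natural numbers; a program can address finitely many arrays by name, and arrays can be indexed
by computed values. A scalar variable is an array used at index `0` only. -/

/-- `s a i` is the content of cell `i` of array `a`. -/
abbrev Store := ℕ → ℕ → ℕ

inductive Expr where
  | const (k : ℕ)
  | read (a : ℕ) (i : Expr)
  | add (e₁ e₂ : Expr)
  | sub (e₁ e₂ : Expr)

def Expr.eval (s : Store) : Expr → ℕ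
  | const k => k
  | read a i => s a (i.eval s)
  | add e₁ e₂ => e₁.eval s + e₂.eval s
  | sub e₁ e₂ => e₁.eval s - e₂.eval s

/-- The number of elementary operations that an evaluation takes. -/
def Expr.cost : Expr → ℕ
  | const _ => 1
  | read _ i => i.cost + 1
  | add e₁ e₂ => e₁.cost + e₂.cost + 1
  | sub e₁ e₂ => e₁.cost + e₂.cost + 1

inductive Program where
  | skip
  | write (a : ℕ) (i e : Expr)
  | seq (p q : Program)
  | ite (e : Expr) (p q : Program)
  | loop (e : Expr) (p : Program)

/-- Write `v` into cell `i` of array `a`. -/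
def Store.set (s : Store) (a i v : ℕ) : Store :=
  fun a' i' => if a' = a ∧ i' = i then v else s a' i'

/-- `Exec p s s' T`: started in store `s`, the program `p` halts in store `s'` after exactly
`T` elementary steps. In `ite e p q` the branch `p` is taken iff `e` is nonzero; `loop e p`
repeats `p` while `e` is nonzero. -/
inductive Exec : Program → Store → Store → ℕ → Prop
  | skip (s) : Exec .skip s s 1
  | write (a i e s) :
      Exec (.write a i e) s (s.set a (i.eval s) (e.eval s)) (i.cost + e.cost + 1)
  | seq {p q s s₁ s₂ T₁ T₂} (hp : Exec p s s₁ T₁) (hq : Exec q s₁ s₂ T₂) :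
      Exec (.seq p q) s s₂ (T₁ + T₂)
  | ite_true {e p q s s₁ T} (he : e.eval s ≠ 0) (hp : Exec p s s₁ T) :
      Exec (.ite e p q) s s₁ (e.cost + 1 + T)
  | ite_false {e p q s s₁ T} (he : e.eval s = 0) (hq : Exec q s s₁ T) :
      Exec (.ite e p q) s s₁ (e.cost + 1 + T)
  | loop_done {e p s} (he : e.eval s = 0) : Exec (.loop e p) s s (e.cost + 1)
  | loop_step {e p s s₁ s₂ T₁ T₂} (he : e.eval s ≠ 0) (hp : Exec p s s₁ T₁)
      (hl : Exec (.loop e p) s₁ s₂ T₂) : Exec (.loop e p) s s₂ (e.cost + 1 + T₁ + T₂)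

/-! ### Input and output conventions -/

open Classical in
/-- The input `(G, t)`: array `0` holds `n`, array `1` holds `t`, array `2` holds the adjacency
matrix of `G` row by row; all other cells are `0`. -/
noncomputable def input {n : ℕ} (G : SimpleGraph (Fin n)) (t : ℕ) : Store := fun a i =>
  if a = 0 ∧ i = 0 then n
  else if a = 1 ∧ i = 0 then t
  else if a = 2 ∧ ∃ u v : Fin n, G.Adj u v ∧ i = u.val * n + v.val then 1
  else 0

/-- The output: `NO` if array `3` holds `0` at index `0`; otherwise array `4` holds at index `0`
a number `k`, and array `5` holds row by row a `k × n` membership matrix of `k` vertex sets. -/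
def output (n : ℕ) (s : Store) : Option (Finset (Finset (Fin n))) :=
  if s 3 0 = 0 then none
  else some ((Finset.range (s 4 0)).image fun l =>
    Finset.univ.filter fun v : Fin n => s 5 (l * n + v.val) ≠ 0)

end ACC

namespace ACC

-- Coverage, degeneracy edge permutations and the first uncovered edge

section SearchTheory

set_option linter.unusedSectionVars false

variable {V : Type*} [DecidableEq V]

-- The search is complete by an exchange argument (`accs_isSome`). Suppose that the current cliques
-- together with a family `S` cover all edges, with `S` within the budget. The first uncovered edge
-- `{x, y}` lies in some `K ∈ S`. Trim `K` to its vertices that are not before `x`: the result is a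
-- candidate clique, it is no larger than `K`, and every edge lost has an endpoint before `x`, hence
-- comes earlier in the permutation and is covered already. So the candidate can replace `K`, and
-- induction on the budget applies. Every candidate contains an edge, so each level costs at least 2
-- and the depth is at most `t / 2`. With at most `t` non-isolated vertices a node has fewer than `2
-- ^ t` children, so the tree has at most `2 ^ (t * (t / 2))` nodes, and `2 ≤ 1.4143 ^ 2`
-- (`two_pow_le_of_two_mul_le`) gives the bound.
--
-- The machine does not simulate the recursion. It uses the notion of a `Path`: a sequence of
-- candidates, each chosen for the edge that is first uncovered at that moment, that stays within
-- the budget and ends in a full cover. A successful run traces a path (`exists_path_of_accs`).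
-- Conversely, every path is the successful run for a suitable order of enumeration, namely one that
-- puts the cliques of the path first (`Path.exists_enumeratesCliques`). Since that order may depend
-- on the output, it is enough for the program to find any path at all.
--
-- A path has at most `min (n * n) (t / 2)` cliques, and all their members are non-isolated. If more
-- than `t` vertices are non-isolated, there is no solution (`IsSolution.ncard_le`), and the program
-- answers NO at once. Otherwise a path is encoded by a 0/1 matrix with at most `t / 2` rows and at
-- most `t` relevant columns. A binary counter runs through the at most `2 ^ (t ^ 2 / 2)` matrices,
-- and each is tested in time polynomial in `n` by one scan over the edges in a fixed lexicographic
-- permutation (`checkCmd_sound`, `checkCmd_complete`). If no matrix passes, there is no path, so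
-- the search fails for every enumeration (`accs_eq_none`). The ordering itself comes from
-- repeatedly removing a vertex of minimum degree (`IsElimination.exists_ordering`).

/-- `Z` is a candidate for the edge `{x, y}`: a clique of `G[N_d[x] ∩ N[y]]` through `x`, `y`. -/
def IsCandidate {n : ℕ} (G : SimpleGraph V) (σ : V ≃ Fin n) (x y : V) (Z : Finset V) : Prop :=
  G.IsClique (Z : Set V) ∧ x ∈ Z ∧ y ∈ Z ∧ (Z : Set V) ⊆ restrictedSet G σ x y

theorem IsCandidate.two_le_card {n : ℕ} {G : SimpleGraph V} {σ : V ≃ Fin n} {x y : V}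
    {Z : Finset V} (h : IsCandidate G σ x y Z) (hxy : y ∈ laterNbrs G σ x) : 2 ≤ Z.card := by
  have hne : x ≠ y := hxy.1.ne
  calc 2 = ({x, y} : Finset V).card := (Finset.card_pair hne).symm
    _ ≤ Z.card := Finset.card_le_card (by
        intro v hv
        rcases Finset.mem_insert.1 hv with rfl | hv
        · exact h.2.1
        · rw [Finset.mem_singleton.1 hv]; exact h.2.2.1)

theorem IsCandidate.exists_adj {n : ℕ} {G : SimpleGraph V} {σ : V ≃ Fin n} {x y : V}
    {Z : Finset V} (h : IsCandidate G σ x y Z) (hxy : y ∈ laterNbrs G σ x) {v : V} (hv : v ∈ Z) :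
    ∃ w, G.Adj v w := by
  by_cases hvx : v = x
  · exact ⟨y, hvx ▸ hxy.1⟩
  · exact ⟨x, h.1 hv h.2.1 hvx⟩

theorem IsDEP.mem_iff {n : ℕ} {G : SimpleGraph V} {σ : V ≃ Fin n} {π : List (V × V)}
    (h : IsDEP G σ π) (x y : V) : (x, y) ∈ π ↔ y ∈ laterNbrs G σ x := by
  obtain ⟨b, hb, rfl⟩ := h
  simp only [List.mem_flatMap, List.mem_finRange, true_and, List.mem_map, Prod.mk.injEq]
  constructor
  · rintro ⟨i, y', hy', rfl, rfl⟩
    exact ((hb _).2 _).1 hy'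
  · intro hy
    exact ⟨σ x, y, by simpa using ((hb x).2 y).2 hy, by simp, rfl⟩

theorem IsDEP.pairwise {n : ℕ} {G : SimpleGraph V} {σ : V ≃ Fin n} {π : List (V × V)}
    (h : IsDEP G σ π) : π.Pairwise fun e e' => σ e.1 ≤ σ e'.1 := by
  obtain ⟨b, hb, rfl⟩ := h
  rw [List.pairwise_flatMap]
  constructor
  · intro i _
    rw [List.pairwise_map]
    exact List.pairwise_of_forall (by simp)
  · refine (List.pairwise_lt_finRange n).imp ?_
    intro i j hij e he e' he'
    obtain ⟨_, _, rfl⟩ := List.mem_map.1 he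
    obtain ⟨_, _, rfl⟩ := List.mem_map.1 he'
    simpa using hij.le

/-- The first edge of `π` that is not covered by `C`. -/
def firstUncovered (π : List (V × V)) (C : Finset (Finset V)) : Option (V × V) :=
  π.find? (fun e => decide (¬ Covered C e.1 e.2))

theorem IsDEP.mem_of_firstUncovered {n : ℕ} {G : SimpleGraph V} {σ : V ≃ Fin n}
    {π : List (V × V)} (h : IsDEP G σ π) {C : Finset (Finset V)} {x y : V}
    (hf : firstUncovered π C = some (x, y)) : y ∈ laterNbrs G σ x :=
  (h.mem_iff x y).1 (List.mem_of_find?_eq_some hf)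

theorem not_covered_of_firstUncovered {π : List (V × V)} {C : Finset (Finset V)} {x y : V}
    (hf : firstUncovered π C = some (x, y)) : ¬ Covered C x y := by
  simpa using List.find?_some hf

theorem Covered.mono {C D : Finset (Finset V)} (hCD : C ⊆ D) {x y : V} (h : Covered C x y) :
    Covered D x y := by
  obtain ⟨K, hK, hx, hy⟩ := h
  exact ⟨K, hCD hK, hx, hy⟩

theorem Covered.symm {C : Finset (Finset V)} {x y : V} (h : Covered C x y) : Covered C y x := by
  obtain ⟨K, hK, hx, hy⟩ := h
  exact ⟨K, hK, hy, hx⟩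

/-- An edge is listed in the block of its earlier endpoint. If one endpoint precedes `x`, so does
the earlier one, and the whole block lies before that of `x`. This is the only property of the order
of edges that the completeness proof needs. -/
theorem IsDEP.covered_of_lt {n : ℕ} {G : SimpleGraph V} {σ : V ≃ Fin n} {π : List (V × V)}
    (h : IsDEP G σ π) {C : Finset (Finset V)} {x y : V}
    (hf : firstUncovered π C = some (x, y)) {a b : V} (hab : G.Adj a b) (ha : σ a < σ x) :
    Covered C a b := by
  obtain ⟨-, l₁, l₂, hπ, hl₁⟩ := List.find?_eq_some_iff_append.1 hf
  have key : ∀ a b : V, b ∈ laterNbrs G σ a → σ a < σ x → Covered C a b := by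
    intro a b hb ha
    have hmem := (h.mem_iff a b).2 hb
    have hpw := h.pairwise
    rw [hπ] at hmem hpw
    rcases List.mem_append.1 hmem with hm | hm
    · simpa using hl₁ _ hm
    · have := (List.pairwise_append.1 hpw).2.1
      rcases List.mem_cons.1 hm with hm | hm
      · cases hm; exact absurd ha (lt_irrefl _)
      · exact absurd ha (not_lt.2 ((List.pairwise_cons.1 this).1 _ hm))
  rcases lt_trichotomy (σ a) (σ b) with hlt | heq | hgt
  · exact key a b ⟨hab, hlt⟩ ha
  · exact absurd (σ.injective heq) hab.ne
  · exact (key b a ⟨hab.symm, hgt⟩ (hgt.trans ha)).symm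

theorem IsDEP.covered_of_firstUncovered_eq_none {n : ℕ} {G : SimpleGraph V} {σ : V ≃ Fin n}
    {π : List (V × V)} (h : IsDEP G σ π) {C : Finset (Finset V)}
    (hf : firstUncovered π C = none) {a b : V} (hab : G.Adj a b) : Covered C a b := by
  have key : ∀ a b : V, b ∈ laterNbrs G σ a → Covered C a b := by
    intro a b hb
    simpa using List.find?_eq_none.1 hf _ ((h.mem_iff a b).2 hb)
  rcases lt_trichotomy (σ a) (σ b) with hlt | heq | hgt
  · exact key a b ⟨hab, hlt⟩
  · exact absurd (σ.injective heq) hab.ne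
  · exact (key b a ⟨hab.symm, hgt⟩).symm

-- Unfolding the search

theorem accs_of_none {π : List (V × V)} {cl : V → V → List (Finset V)} {t : ℕ}
    {C : Finset (Finset V)} (hf : firstUncovered π C = none) :
    accs π cl t C = ⟨some C, 0, 1⟩ := by
  unfold firstUncovered at hf
  rw [accs, hf]

theorem accs_of_some {π : List (V × V)} {cl : V → V → List (Finset V)} {t : ℕ}
    {C : Finset (Finset V)} {x y : V} (hf : firstUncovered π C = some (x, y)) :
    accs π cl t C = if t < 2 then ⟨none, 0, 1⟩ else
      ⟨(accsLoop π cl t C (cl x y)).result, (accsLoop π cl t C (cl x y)).depth,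
        (accsLoop π cl t C (cl x y)).nodes + 1⟩ := by
  unfold firstUncovered at hf
  rw [accs, hf]

theorem accsLoop_nil {π : List (V × V)} {cl : V → V → List (Finset V)} {t : ℕ}
    {C : Finset (Finset V)} : accsLoop π cl t C [] = ⟨none, 0, 0⟩ := by
  rw [accsLoop]

theorem accsLoop_cons {π : List (V × V)} {cl : V → V → List (Finset V)} {t : ℕ}
    {C : Finset (Finset V)} {Z : Finset V} {Zs : List (Finset V)} :
    accsLoop π cl t C (Z :: Zs) =
      if 0 < Z.card ∧ Z.card ≤ t then
        if (accs π cl (t - Z.card) (insert Z C)).result.isSome then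
          ⟨(accs π cl (t - Z.card) (insert Z C)).result,
            (accs π cl (t - Z.card) (insert Z C)).depth + 1,
            (accs π cl (t - Z.card) (insert Z C)).nodes⟩
        else
          ⟨(accsLoop π cl t C Zs).result,
            max ((accs π cl (t - Z.card) (insert Z C)).depth + 1) (accsLoop π cl t C Zs).depth,
            (accs π cl (t - Z.card) (insert Z C)).nodes + (accsLoop π cl t C Zs).nodes⟩
      else accsLoop π cl t C Zs := by
  rw [accsLoop]

theorem accsLoop_isSome {π : List (V × V)} {cl : V → V → List (Finset V)} {t : ℕ}
    {C : Finset (Finset V)} {Z : Finset V} {Zs : List (Finset V)} (hZ : Z ∈ Zs)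
    (h0 : 0 < Z.card) (ht : Z.card ≤ t)
    (hs : (accs π cl (t - Z.card) (insert Z C)).result.isSome) :
    (accsLoop π cl t C Zs).result.isSome := by
  induction Zs with
  | nil => simp at hZ
  | cons Y Zs ih =>
    rw [accsLoop_cons]
    rcases List.mem_cons.1 hZ with rfl | hZ
    · rw [if_pos ⟨h0, ht⟩, if_pos hs]; exact hs
    · split_ifs with h1 h2
      · exact h2
      · exact ih hZ
      · exact ih hZ

theorem exists_of_accsLoop_eq_some {π : List (V × V)} {cl : V → V → List (Finset V)} {t : ℕ}
    {C C' : Finset (Finset V)} {Zs : List (Finset V)}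
    (h : (accsLoop π cl t C Zs).result = some C') :
    ∃ Z ∈ Zs, 0 < Z.card ∧ Z.card ≤ t ∧
      (accs π cl (t - Z.card) (insert Z C)).result = some C' := by
  induction Zs with
  | nil => rw [accsLoop_nil] at h; simp at h
  | cons Y Zs ih =>
    rw [accsLoop_cons] at h
    split_ifs at h with h1 h2
    · exact ⟨Y, by simp, h1.1, h1.2, h⟩
    · obtain ⟨Z, hZ, hh⟩ := ih h
      exact ⟨Z, by simp [hZ], hh⟩
    · obtain ⟨Z, hZ, hh⟩ := ih h
      exact ⟨Z, by simp [hZ], hh⟩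

-- Paths of the search

/-- `Path G σ π t C Zs C'`: starting with budget `t` and cliques `C`, the search can reach the
complete cover `C'` by choosing, one after the other, the candidates in `Zs`. -/
inductive Path {n : ℕ} (G : SimpleGraph V) (σ : V ≃ Fin n) (π : List (V × V)) :
    ℕ → Finset (Finset V) → List (Finset V) → Finset (Finset V) → Prop
  | done {t C} (hf : firstUncovered π C = none) : Path G σ π t C [] C
  | step {t C x y Z Zs C'} (hf : firstUncovered π C = some (x, y)) (hZ : IsCandidate G σ x y Z)
      (ht : Z.card ≤ t) (hp : Path G σ π (t - Z.card) (insert Z C) Zs C') :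
      Path G σ π t C (Z :: Zs) C'

section

variable {n : ℕ} {G : SimpleGraph V} {σ : V ≃ Fin n} {π : List (V × V)}
  {cl : V → V → List (Finset V)}

theorem exists_path_of_accs (hπ : IsDEP G σ π) (hcl : EnumeratesCliques G σ cl) {t : ℕ}
    {C C' : Finset (Finset V)} (h : (accs π cl t C).result = some C') :
    ∃ Zs, Path G σ π t C Zs C' := by
  induction t using Nat.strong_induction_on generalizing C with
  | _ t ih =>
    rcases hf : firstUncovered π C with _ | ⟨x, y⟩
    · rw [accs_of_none hf] at h
      cases h
      exact ⟨[], .done hf⟩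
    · rw [accs_of_some hf] at h
      split_ifs at h with h2
      obtain ⟨Z, hZ, h0, ht, hr⟩ := exists_of_accsLoop_eq_some h
      obtain ⟨Zs, hp⟩ := ih (t - Z.card) (by omega) hr
      exact ⟨Z :: Zs, .step hf (((hcl x y (hπ.mem_of_firstUncovered hf)).2 Z).1 hZ) ht hp⟩

theorem Path.spec (hπ : IsDEP G σ π) {t : ℕ} {C C' : Finset (Finset V)} {Zs : List (Finset V)}
    (h : Path G σ π t C Zs C') :
    (∀ K ∈ C', K ∈ C ∨ G.IsClique (K : Set V)) ∧ (∀ x y, G.Adj x y → Covered C' x y) ∧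
      ∑ K ∈ C', K.card ≤ ∑ K ∈ C, K.card + t := by
  induction h with
  | done hf => exact ⟨fun K hK => .inl hK, fun x y => hπ.covered_of_firstUncovered_eq_none hf,
      by omega⟩
  | @step t C x y Z Zs C' hf hZ ht hp ih =>
    obtain ⟨h1, h2, h3⟩ := ih
    refine ⟨fun K hK => ?_, h2, ?_⟩
    · rcases h1 K hK with h | h
      · rcases Finset.mem_insert.1 h with rfl | h
        · exact .inr hZ.1
        · exact .inl h
      · exact .inr h
    -- The new clique contains an uncovered edge, so it is not in `C` yet and inserting it adds its
    -- full size to the sum.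
    · have hZC : Z ∉ C := fun h => not_covered_of_firstUncovered hf ⟨Z, h, hZ.2.1, hZ.2.2.1⟩
      rw [Finset.sum_insert hZC] at h3
      omega

theorem Path.isSolution (hπ : IsDEP G σ π) {t : ℕ} {C' : Finset (Finset V)}
    {Zs : List (Finset V)} (h : Path G σ π t ∅ Zs C') : IsSolution G t C' := by
  obtain ⟨h1, h2, h3⟩ := h.spec hπ
  exact ⟨fun K hK => (h1 K hK).resolve_left (by simp), h2, by simpa using h3⟩

theorem Path.two_mul_length_le (hπ : IsDEP G σ π) {t : ℕ} {C C' : Finset (Finset V)}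
    {Zs : List (Finset V)} (h : Path G σ π t C Zs C') : 2 * Zs.length ≤ t := by
  induction h with
  | done hf => simp
  | step hf hZ ht hp ih =>
    have := hZ.two_le_card (hπ.mem_of_firstUncovered hf)
    simp only [List.length_cons]
    omega

/-- Every chosen clique covers a pair that was uncovered before. The resulting bound `n * n` does
not depend on `t`, which keeps a single check polynomial in `n`. -/
theorem Path.length_le [Fintype V] {t : ℕ} {C C' : Finset (Finset V)}
    {Zs : List (Finset V)} (h : Path G σ π t C Zs C') :
    Zs.length ≤ (Finset.univ.filter fun e : V × V => ¬ Covered C e.1 e.2).card := by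
  induction h with
  | done hf => simp
  | @step t C x y Z Zs C' hf hZ ht hp ih =>
    refine Nat.succ_le_of_lt (ih.trans_lt (Finset.card_lt_card ?_))
    rw [Finset.ssubset_iff_of_subset]
    · exact ⟨(x, y), by simpa using not_covered_of_firstUncovered hf,
        by simpa using ⟨Z, by simp, hZ.2.1, hZ.2.2.1⟩⟩
    · intro e he
      simp only [Finset.mem_filter, Finset.mem_univ, true_and] at he ⊢
      exact fun hc => he (hc.mono (Finset.subset_insert _ _))

/-- This permits the matrices to omit the columns of isolated vertices, so that the exponent depends
on `t` and not on `n`. -/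
theorem Path.adj_of_mem (hπ : IsDEP G σ π) {t : ℕ} {C C' : Finset (Finset V)}
    {Zs : List (Finset V)} (h : Path G σ π t C Zs C') :
    ∀ Z ∈ Zs, ∀ v ∈ Z, ∃ w, G.Adj v w := by
  induction h with
  | done hf => simp
  | step hf hZ ht hp ih =>
    intro Y hY v hv
    rcases List.mem_cons.1 hY with rfl | hY
    · exact hZ.exists_adj (hπ.mem_of_firstUncovered hf) hv
    · exact ih Y hY v hv

/-- The search follows a given path if the candidates of the path are enumerated first. -/
theorem Path.exists_preference (hπ : IsDEP G σ π) {t : ℕ} {C C' : Finset (Finset V)}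
    {Zs : List (Finset V)} (h : Path G σ π t C Zs C') :
    ∃ pref : V → V → Option (Finset V),
      (∀ x y Z, pref x y = some Z → ¬ Covered C x y ∧ IsCandidate G σ x y Z) ∧
      ∀ cl : V → V → List (Finset V), (∀ x y Z, pref x y = some Z → (cl x y).head? = some Z) →
        (accs π cl t C).result = some C' := by
  induction h with
  | done hf => exact ⟨fun _ _ => none, by simp, fun cl _ => by rw [accs_of_none hf]⟩
  | @step t C x y Z Zs C' hf hZ ht hp ih =>
    obtain ⟨pref, h1, h2⟩ := ih
    have h2Z := hZ.two_le_card (hπ.mem_of_firstUncovered hf)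
    -- The preferences of the rest of the path concern only pairs that `insert Z C` leaves
    -- uncovered. The pair `(x, y)` is not one of them, so the new preference overrides nothing.
    refine ⟨fun a b => if a = x ∧ b = y then some Z else pref a b, ?_, ?_⟩
    · intro a b Y hY
      simp only at hY
      split_ifs at hY with hab
      · obtain ⟨rfl, rfl⟩ := hab
        cases hY
        exact ⟨not_covered_of_firstUncovered hf, hZ⟩
      · obtain ⟨h3, h4⟩ := h1 a b Y hY
        exact ⟨fun hc => h3 (hc.mono (Finset.subset_insert _ _)), h4⟩
    · intro cl hcl
      have hcov : Covered (insert Z C) x y := ⟨Z, by simp, hZ.2.1, hZ.2.2.1⟩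
      have hr := h2 cl (fun a b Y hY => hcl a b Y (by
        have : ¬ (a = x ∧ b = y) := by
          rintro ⟨rfl, rfl⟩
          exact (h1 _ _ _ hY).1 hcov
        simp only [this, if_false, hY]))
      have hhead := hcl x y Z (by simp)
      obtain ⟨l, hl⟩ : ∃ l, cl x y = Z :: l := by
        rcases hc : cl x y with _ | ⟨Y, l⟩
        · simp [hc] at hhead
        · simp only [hc, List.head?_cons, Option.some.injEq] at hhead
          exact ⟨l, by rw [hhead]⟩
      rw [accs_of_some hf, if_neg (by omega), hl, accsLoop_cons, if_pos ⟨by omega, ht⟩,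
        if_pos (by rw [hr]; rfl)]
      exact hr

open Classical in
theorem exists_enumeratesCliques [Fintype V] (G : SimpleGraph V) (σ : V ≃ Fin n)
    (pref : V → V → Option (Finset V))
    (hpref : ∀ x y Z, pref x y = some Z → IsCandidate G σ x y Z) :
    ∃ cl, EnumeratesCliques G σ cl ∧
      ∀ x y Z, pref x y = some Z → (cl x y).head? = some Z := by
  refine ⟨fun x y => match pref x y with
    | none => (Finset.univ.filter fun Z => IsCandidate G σ x y Z).toList
    | some Z => Z :: ((Finset.univ.filter fun Z => IsCandidate G σ x y Z).toList.erase Z),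
    ?_, ?_⟩
  · intro x y _
    dsimp only
    rcases hp : pref x y with _ | Z
    · exact ⟨Finset.nodup_toList _, fun Y => by
        rw [Finset.mem_toList, Finset.mem_filter]; simp [IsCandidate]⟩
    · have hnd := Finset.nodup_toList (Finset.univ.filter fun Z => IsCandidate G σ x y Z)
      refine ⟨List.nodup_cons.2 ⟨hnd.not_mem_erase, hnd.erase _⟩, fun Y => ?_⟩
      have hZ := hpref x y Z hp
      change _ ↔ IsCandidate G σ x y Y
      rw [List.mem_cons, hnd.mem_erase_iff]
      simp only [Finset.mem_toList, Finset.mem_filter, Finset.mem_univ, true_and]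
      constructor
      · rintro (rfl | h)
        · exact hZ
        · exact h.2
      · intro h
        by_cases hYZ : Y = Z
        · exact .inl hYZ
        · exact .inr ⟨hYZ, h⟩
  · intro x y Z hp
    simp [hp]

theorem Path.exists_enumeratesCliques [Fintype V] (hπ : IsDEP G σ π) {t : ℕ}
    {C C' : Finset (Finset V)} {Zs : List (Finset V)} (h : Path G σ π t C Zs C') :
    ∃ cl, EnumeratesCliques G σ cl ∧ (accs π cl t C).result = some C' := by
  obtain ⟨pref, h1, h2⟩ := h.exists_preference hπ
  obtain ⟨cl, h3, h4⟩ := ACC.exists_enumeratesCliques G σ pref fun x y Z hZ => (h1 x y Z hZ).2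
  exact ⟨cl, h3, h2 cl h4⟩

-- Correctness of the search

/-- Strengthened for the induction: `S` is what remains of a solution after the choices in `C`, and
need not cover anything that `C` covers. -/
theorem accs_isSome (hπ : IsDEP G σ π) (hcl : EnumeratesCliques G σ cl) {t : ℕ}
    {C S : Finset (Finset V)} (hS : ∀ K ∈ S, G.IsClique (K : Set V))
    (hcov : ∀ x y, G.Adj x y → Covered (C ∪ S) x y) (hsum : ∑ K ∈ S, K.card ≤ t) :
    (accs π cl t C).result.isSome := by
  induction t using Nat.strong_induction_on generalizing C S with
  | _ t ih =>
    rcases hf : firstUncovered π C with _ | ⟨x, y⟩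
    · rw [accs_of_none hf]; rfl
    have hxy := hπ.mem_of_firstUncovered hf
    have hunc := not_covered_of_firstUncovered hf
    obtain ⟨K, hK, hxK, hyK⟩ := hcov x y hxy.1
    have hKS : K ∈ S := (Finset.mem_union.1 hK).resolve_left fun h => hunc ⟨K, h, hxK, hyK⟩
    -- `K` itself may reach vertices before `x` and then is no candidate; its part from `x` on
    -- always is.
    set Z := K.filter fun v => σ x ≤ σ v with hZdef
    have hZK : Z ⊆ K := Finset.filter_subset _ _
    have hZ : IsCandidate G σ x y Z := by
      refine ⟨(hS K hKS).subset (by exact_mod_cast hZK), by simp [Z, hxK],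
        by simp [Z, hyK, hxy.2.le], ?_⟩
      intro v hv
      have hv' : v ∈ K ∧ σ x ≤ σ v := by simpa [Z] using hv
      refine ⟨?_, ?_⟩
      · by_cases hvx : v = x
        · exact .inl hvx
        · refine .inr ⟨(hS K hKS) hxK hv'.1 (Ne.symm hvx), lt_of_le_of_ne hv'.2 ?_⟩
          exact fun h => hvx (σ.injective h.symm)
      · by_cases hvy : v = y
        · exact .inl hvy
        · exact .inr ((hS K hKS) hyK hv'.1 (Ne.symm hvy))
    have h2 := hZ.two_le_card hxy
    have hZc : Z.card ≤ K.card := Finset.card_le_card hZK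
    have hsplit : K.card + ∑ K ∈ S.erase K, K.card = ∑ K ∈ S, K.card :=
      Finset.add_sum_erase S Finset.card hKS
    have hr := ih (t - Z.card) (by omega) (C := insert Z C) (S := S.erase K)
      (fun Y hY => hS Y (Finset.mem_of_mem_erase hY)) (by
        intro a b hab
        obtain ⟨Y, hY, haY, hbY⟩ := hcov a b hab
        by_cases hYK : Y = K
        -- An edge of `K` either has an endpoint before `x`, and is covered by `C`, or lies inside
        -- `Z`.
        · subst hYK
          by_cases ha : σ a < σ x
          · exact (hπ.covered_of_lt hf hab ha).mono (by
              intro K; simp only [Finset.mem_union, Finset.mem_insert]; tauto)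
          by_cases hb : σ b < σ x
          · exact (hπ.covered_of_lt hf hab.symm hb).symm.mono (by
              intro K; simp only [Finset.mem_union, Finset.mem_insert]; tauto)
          exact ⟨Z, by simp, by simp [Z, haY, not_lt.1 ha], by simp [Z, hbY, not_lt.1 hb]⟩
        · refine ⟨Y, ?_, haY, hbY⟩
          simp only [Finset.mem_union, Finset.mem_insert, Finset.mem_erase] at hY ⊢
          tauto) (by omega)
    rw [accs_of_some hf, if_neg (by omega)]
    exact accsLoop_isSome (((hcl x y hxy).2 Z).2 hZ) (by omega) (by omega) hr

theorem accs_isAnswer (hπ : IsDEP G σ π) (hcl : EnumeratesCliques G σ cl) (t : ℕ) :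
    IsAnswer G t (accs π cl t ∅).result := by
  rcases hr : (accs π cl t ∅).result with _ | C
  · rintro ⟨S, h1, h2, h3⟩
    have := accs_isSome hπ hcl (C := ∅) h1 (by simpa using h2) h3
    simp [hr] at this
  · obtain ⟨Zs, hp⟩ := exists_path_of_accs hπ hcl hr
    exact hp.isSolution hπ

-- Depth and size of the search tree

theorem two_mul_accs_depth_le (hπ : IsDEP G σ π) (hcl : EnumeratesCliques G σ cl) (t : ℕ)
    (C : Finset (Finset V)) : 2 * (accs π cl t C).depth ≤ t := by
  induction t using Nat.strong_induction_on generalizing C with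
  | _ t ih =>
    rcases hf : firstUncovered π C with _ | ⟨x, y⟩
    · rw [accs_of_none hf]; simp
    rw [accs_of_some hf]
    have hxy := hπ.mem_of_firstUncovered hf
    have hloop : ∀ Zs : List (Finset V), (∀ Z ∈ Zs, 2 ≤ Z.card) →
        2 * (accsLoop π cl t C Zs).depth ≤ t := by
      intro Zs
      induction Zs with
      | nil => intro _; rw [accsLoop_nil]; simp
      | cons Z Zs ihZ =>
        intro hc
        have h1 := ihZ fun Y hY => hc Y (by simp [hY])
        have h2 := hc Z (by simp)
        rw [accsLoop_cons]
        split_ifs with h3 h4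
        · have := ih (t - Z.card) (by omega) (insert Z C)
          dsimp only
          omega
        · have := ih (t - Z.card) (by omega) (insert Z C)
          dsimp only
          omega
        · exact h1
    split_ifs
    · simp
    · exact hloop _ fun Z hZ => IsCandidate.two_le_card (((hcl x y hxy).2 Z).1 hZ) hxy

theorem accs_nodes_le (hπ : IsDEP G σ π) (hcl : EnumeratesCliques G σ cl) (B : ℕ)
    (hB : ∀ x, ∀ y ∈ laterNbrs G σ x, (cl x y).length ≤ B) (t : ℕ) (C : Finset (Finset V)) :
    (accs π cl t C).nodes ≤ (B + 1) ^ (t / 2) := by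
  induction t using Nat.strong_induction_on generalizing C with
  | _ t ih =>
    rcases hf : firstUncovered π C with _ | ⟨x, y⟩
    · rw [accs_of_none hf]; exact Nat.one_le_pow _ _ (by omega)
    rw [accs_of_some hf]
    have hxy := hπ.mem_of_firstUncovered hf
    have hloop : ∀ Zs : List (Finset V), (∀ Z ∈ Zs, 2 ≤ Z.card) →
        (accsLoop π cl t C Zs).nodes ≤ Zs.length * (B + 1) ^ (t / 2 - 1) := by
      intro Zs
      induction Zs with
      | nil => intro _; rw [accsLoop_nil]; simp
      | cons Z Zs ihZ =>
        intro hc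
        have h1 := ihZ fun Y hY => hc Y (by simp [hY])
        have h2 := hc Z (by simp)
        have h5 : Z.card ≤ t →
            (accs π cl (t - Z.card) (insert Z C)).nodes ≤ (B + 1) ^ (t / 2 - 1) := fun ht =>
          (ih (t - Z.card) (by omega) (insert Z C)).trans
            (Nat.pow_le_pow_right (by omega) (by omega))
        rw [accsLoop_cons, List.length_cons, Nat.succ_mul]
        split_ifs with h3 h4
        · have := h5 h3.2
          dsimp only
          omega
        · have := h5 h3.2
          dsimp only
          omega
        · omega
    split_ifs with h2
    · exact Nat.one_le_pow _ _ (by omega)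
    · have h3 := hloop (cl x y) fun Z hZ =>
        IsCandidate.two_le_card (((hcl x y hxy).2 Z).1 hZ) hxy
      have h4 := Nat.mul_le_mul_right ((B + 1) ^ (t / 2 - 1)) (hB x y hxy)
      -- A node with at most `B` children has at most `1 + B * (B + 1) ^ (t / 2 - 1)` nodes below
      -- and including it. The base `B + 1` instead of `B` absorbs the node itself.
      have h5 : (B + 1) ^ (t / 2) = B * (B + 1) ^ (t / 2 - 1) + (B + 1) ^ (t / 2 - 1) := by
        rw [← Nat.succ_mul, Nat.succ_eq_add_one, ← pow_succ']
        congr 1; omega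
      have h6 : 1 ≤ (B + 1) ^ (t / 2 - 1) := Nat.one_le_pow _ _ (by omega)
      dsimp only
      omega

/-- All candidates contain `x`, so erasing `x` is injective on them and leaves subsets of the other
non-isolated vertices: at most `2 ^ (m - 1) ≤ 2 ^ m - 1` for `m` such vertices. The weaker form
makes `B + 1` a power of two in `accs_nodes_le`. -/
theorem length_le_of_enumeratesCliques [Finite V] (hcl : EnumeratesCliques G σ cl) {x y : V}
    (hxy : y ∈ laterNbrs G σ x) :
    (cl x y).length ≤ 2 ^ {v : V | ∃ w, G.Adj v w}.ncard - 1 := by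
  set S := {v : V | ∃ w, G.Adj v w} with hS
  have hfin : S.Finite := Set.toFinite _
  obtain ⟨hnd, hmem⟩ := hcl x y hxy
  have hxS : x ∈ hfin.toFinset := by simpa [hS] using ⟨y, hxy.1⟩
  rw [Set.ncard_eq_toFinset_card S hfin]
  have h1 : ((cl x y).map fun Z => Z.erase x).toFinset ⊆ (hfin.toFinset.erase x).powerset := by
    intro Y hY
    obtain ⟨Z, hZ, rfl⟩ := List.mem_map.1 (List.mem_toFinset.1 hY)
    rw [Finset.mem_powerset]
    refine Finset.erase_subset_erase _ fun v hv => ?_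
    simpa [hS] using IsCandidate.exists_adj ((hmem Z).1 hZ) hxy hv
  have h2 : ((cl x y).map fun Z => Z.erase x).Nodup := by
    refine hnd.map_on ?_
    intro Z hZ Y hY h
    rw [← Finset.insert_erase ((hmem Z).1 hZ).2.1, ← Finset.insert_erase ((hmem Y).1 hY).2.1, h]
  have h3 := Finset.card_le_card h1
  rw [List.toFinset_card_of_nodup h2, List.length_map, Finset.card_powerset,
    Finset.card_erase_of_mem hxS] at h3
  obtain ⟨m, hm⟩ : ∃ m, hfin.toFinset.card = m + 1 :=
    ⟨_, (Nat.succ_pred_eq_of_pos (Finset.card_pos.2 ⟨x, hxS⟩)).symm⟩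
  rw [hm] at h3 ⊢
  simp only [Nat.add_sub_cancel] at h3
  have h4 : 1 ≤ 2 ^ m := Nat.one_le_two_pow
  have h5 : 2 ^ (m + 1) = 2 ^ m + 2 ^ m := by rw [pow_succ]; omega
  omega

end

/-- The constant 1.4143 is an upper approximation of the square root of 2: its square is 2.00024449.
-/
theorem two_pow_le_of_two_mul_le {k t : ℕ} (h : 2 * k ≤ t ^ 2) :
    ((2 ^ k : ℕ) : ℝ) ≤ (1.4143 : ℝ) ^ (t ^ 2) := by
  calc ((2 ^ k : ℕ) : ℝ) = (2 : ℝ) ^ k := by push_cast; rfl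
    _ ≤ ((1.4143 : ℝ) ^ 2) ^ k := by gcongr; norm_num
    _ = (1.4143 : ℝ) ^ (2 * k) := by rw [pow_mul]
    _ ≤ (1.4143 : ℝ) ^ (t ^ 2) := pow_le_pow_right₀ (by norm_num) h

theorem accs_nodes_le_rpow {n : ℕ} {G : SimpleGraph V} {σ : V ≃ Fin n} {π : List (V × V)}
    {cl : V → V → List (Finset V)} [Finite V] (hπ : IsDEP G σ π)
    (hcl : EnumeratesCliques G σ cl) {t : ℕ} (ht : {v : V | ∃ w, G.Adj v w}.ncard ≤ t) :
    ((accs π cl t ∅).nodes : ℝ) ≤ (1.4143 : ℝ) ^ (t ^ 2) := by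
  have h1 := accs_nodes_le hπ hcl (2 ^ t - 1) (fun x y hxy =>
    (length_le_of_enumeratesCliques hcl hxy).trans
      (Nat.sub_le_sub_right (Nat.pow_le_pow_right (by omega) ht) 1)) t ∅
  rw [Nat.sub_add_cancel Nat.one_le_two_pow, ← pow_mul] at h1
  refine le_trans (by exact_mod_cast h1) (two_pow_le_of_two_mul_le (k := t * (t / 2)) ?_)
  have : 2 * (t / 2) ≤ t := Nat.mul_div_le t 2
  nlinarith

/-- Every non-isolated vertex lies on a covered edge, hence in some clique, and the size of a union
is at most the sum of the sizes. -/
theorem IsSolution.ncard_le [Finite V] {G : SimpleGraph V} {t : ℕ} {C : Finset (Finset V)}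
    (h : IsSolution G t C) : {v : V | ∃ w, G.Adj v w}.ncard ≤ t := by
  refine le_trans ?_ h.2.2
  calc {v : V | ∃ w, G.Adj v w}.ncard ≤ ((C.biUnion id : Finset V) : Set V).ncard := by
        refine Set.ncard_le_ncard ?_ (Finset.finite_toSet _)
        rintro v ⟨w, hw⟩
        obtain ⟨K, hK, hv, -⟩ := h.2.1 v w hw
        simpa using ⟨K, hK, hv⟩
    _ = (C.biUnion id).card := Set.ncard_coe_finset _
    _ ≤ ∑ K ∈ C, K.card := Finset.card_biUnion_le

end SearchTheory

/-! ### Programs with bounded loops -/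

/-- Programs all of whose loops run over an initial segment of `ℕ`: `forTo b v p` runs `p` for
`v = 0, …, N - 1`, where `N` is the content of the variable `b`. -/
inductive Cmd where
  | skip
  | write (a : ℕ) (i e : Expr)
  | seq (p q : Cmd)
  | ite (e : Expr) (p q : Cmd)
  | forTo (b v : ℕ) (p : Cmd)

namespace Cmd

/-- The scalar variable `a`. -/
abbrev var (a : ℕ) : Expr := .read a (.const 0)

/-- Assignment to the scalar variable `a`. -/
abbrev assign (a : ℕ) (e : Expr) : Cmd := .write a (.const 0) e

/-- Conditional without alternative. -/
abbrev cond (e : Expr) (p : Cmd) : Cmd := .ite e p .skip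

/-- Conditional on an expression being zero. -/
abbrev condZero (e : Expr) (p : Cmd) : Cmd := .ite e .skip p

/-- Translation to the machine. -/
def toProgram : Cmd → Program
  | skip => .skip
  | write a i e => .write a i e
  | seq p q => .seq p.toProgram q.toProgram
  | ite e p q => .ite e p.toProgram q.toProgram
  | forTo b v p => .seq (.write v (.const 0) (.const 0))
      (.loop (.sub (var b) (var v))
        (.seq p.toProgram (.write v (.const 0) (.add (var v) (.const 1)))))

/-- The store after `k` rounds of a loop with loop variable `v` and body `f`. -/
def forSem (f : Store → Store) (v : ℕ) : ℕ → Store → Store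
  | 0, s => s.set v 0 0
  | k + 1, s => (f (forSem f v k s)).set v 0 (k + 1)

/-- Selection according to whether a number is nonzero. -/
def branch {α : Type*} (c : ℕ) (x y : α) : α := if c = 0 then y else x

theorem branch_zero {α : Type*} (x y : α) : branch 0 x y = y := rfl

theorem branch_of_eq {α : Type*} {c : ℕ} (h : c = 0) (x y : α) : branch c x y = y := if_pos h

theorem branch_of_ne {α : Type*} {c : ℕ} (h : c ≠ 0) (x y : α) : branch c x y = x := if_neg h

/-- The store in which a program halts. -/
def sem : Cmd → Store → Store
  | skip, s => s
  | write a i e, s => s.set a (i.eval s) (e.eval s)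
  | seq p q, s => q.sem (p.sem s)
  | ite e p q, s => branch (e.eval s) (p.sem s) (q.sem s)
  | forTo b v p, s => forSem p.sem v (s b 0) s

/-- The arrays that a program may write to. -/
def mods : Cmd → List ℕ
  | skip => []
  | write a _ _ => [a]
  | seq p q => p.mods ++ q.mods
  | ite _ p q => p.mods ++ q.mods
  | forTo _ v p => v :: p.mods

/-- The variables that bound loops. -/
def bounds : Cmd → List ℕ
  | skip => []
  | write _ _ _ => []
  | seq p q => p.bounds ++ q.bounds
  | ite _ p q => p.bounds ++ q.bounds
  | forTo b _ p => b :: p.bounds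

/-- No loop variable is written to in the body of its loop. -/
def LoopsOk : Cmd → Prop
  | skip => True
  | write _ _ _ => True
  | seq p q => p.LoopsOk ∧ q.LoopsOk
  | ite _ p q => p.LoopsOk ∧ q.LoopsOk
  | forTo _ v p => v ∉ p.mods ∧ p.LoopsOk

/-- A bound for the running time if every loop has at most `X` rounds. -/
def cost (X : ℕ) : Cmd → ℕ
  | skip => 1
  | write _ i e => i.cost + e.cost + 1
  | seq p q => p.cost X + q.cost X
  | ite e p q => e.cost + 1 + (p.cost X + q.cost X)
  -- A round costs 6 for the guard and 6 for the increment besides the body; the 9 is 3 for the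
  -- initialisation and 6 for the final guard.
  | forTo _ _ p => X * (p.cost X + 12) + 9

theorem _root_.ACC.Store.set_of_ne {s : Store} {a a' i v : ℕ} (h : a' ≠ a) :
    s.set a i v a' = s a' := by
  funext i'; simp [Store.set, h]

theorem _root_.ACC.Store.set_apply {s : Store} {a a' i i' v : ℕ} :
    s.set a i v a' i' = if a' = a ∧ i' = i then v else s a' i' := rfl

theorem sem_seq {p q : Cmd} {s : Store} : (p.seq q).sem s = q.sem (p.sem s) := rfl

theorem sem_write {a : ℕ} {i e : Expr} {s : Store} :
    (write a i e).sem s = s.set a (i.eval s) (e.eval s) := rfl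

theorem sem_ite {e : Expr} {p q : Cmd} {s : Store} :
    (ite e p q).sem s = branch (e.eval s) (p.sem s) (q.sem s) := rfl

theorem sem_skip {s : Store} : skip.sem s = s := rfl

theorem forSem_frame {f : Store → Store} {v a : ℕ} (ha : a ≠ v) (hf : ∀ s, f s a = s a)
    (k : ℕ) (s : Store) : forSem f v k s a = s a := by
  induction k with
  | zero => exact Store.set_of_ne ha
  | succ k ih => rw [forSem, Store.set_of_ne ha, hf, ih]

theorem sem_frame {p : Cmd} {a : ℕ} (ha : a ∉ p.mods) (s : Store) : p.sem s a = s a := by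
  induction p generalizing s with
  | skip => rfl
  | write a' i e => exact Store.set_of_ne (by simpa [mods] using ha)
  | seq p q ihp ihq =>
    simp only [mods, List.mem_append, not_or] at ha
    rw [sem, ihq ha.2, ihp ha.1]
  | ite e p q ihp ihq =>
    simp only [mods, List.mem_append, not_or] at ha
    rw [sem, branch]
    split_ifs
    · exact ihq ha.2 s
    · exact ihp ha.1 s
  | forTo b v p ih =>
    simp only [mods, List.mem_cons, not_or] at ha
    exact forSem_frame ha.1 (ih ha.2) _ _

theorem forSem_var {f : Store → Store} {v : ℕ} (k : ℕ) (s : Store) : forSem f v k s v 0 = k := by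
  cases k <;> simp [forSem, Store.set_apply]

/-- Loop invariants. -/
theorem sem_forTo_induction {b v : ℕ} {p : Cmd} {s : Store} (I : ℕ → Store → Prop)
    (h0 : I 0 (s.set v 0 0))
    (hs : ∀ k < s b 0, ∀ s', s' v 0 = k → (∀ a, a ∉ v :: p.mods → s' a = s a) → I k s' →
      I (k + 1) ((p.sem s').set v 0 (k + 1))) :
    I (s b 0) ((forTo b v p).sem s) := by
  have key : ∀ k ≤ s b 0, I k (forSem p.sem v k s) := by
    intro k
    induction k with
    | zero => intro _; exact h0
    | succ k ih =>
      intro hk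
      exact hs k hk _ (forSem_var k s)
        (fun a ha => forSem_frame (fun h => ha (by simp [h]))
          (fun s => sem_frame (fun h => ha (by simp [h])) s) k s) (ih (by omega))
  exact key _ le_rfl

/-- The semantics `sem` reads the bound of a loop once and sets the loop variable outright, whereas
the machine rereads the bound and increments the variable. The two agree because bodies do not write
to their loop variables (`LoopsOk`) and bounds are never written to (`hb`). -/
theorem exec {p : Cmd} (hp : p.LoopsOk) {X : ℕ} {s : Store}
    (hb : ∀ b ∈ p.bounds, b ∉ p.mods ∧ s b 0 ≤ X) :
    ∃ T ≤ p.cost X, Exec p.toProgram s (p.sem s) T := by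
  induction p generalizing s with
  | skip => exact ⟨1, le_rfl, .skip s⟩
  | write a i e => exact ⟨_, le_rfl, .write a i e s⟩
  | seq p q ihp ihq =>
    simp only [bounds, mods, List.mem_append, not_or] at hb
    obtain ⟨T₁, h₁, e₁⟩ := ihp hp.1 (s := s) fun b h => ⟨(hb b (.inl h)).1.1, (hb b (.inl h)).2⟩
    obtain ⟨T₂, h₂, e₂⟩ := ihq hp.2 (s := p.sem s) fun b h =>
      ⟨(hb b (.inr h)).1.2, by rw [sem_frame (hb b (.inr h)).1.1]; exact (hb b (.inr h)).2⟩
    exact ⟨T₁ + T₂, Nat.add_le_add h₁ h₂, .seq e₁ e₂⟩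
  | ite e p q ihp ihq =>
    simp only [bounds, mods, List.mem_append, not_or] at hb
    by_cases he : e.eval s = 0
    · obtain ⟨T, h, e'⟩ := ihq hp.2 (s := s) fun b h => ⟨(hb b (.inr h)).1.2, (hb b (.inr h)).2⟩
      refine ⟨_, ?_, by rw [sem, branch_of_eq he]; exact .ite_false he e'⟩
      simp only [cost]; omega
    · obtain ⟨T, h, e'⟩ := ihp hp.1 (s := s) fun b h => ⟨(hb b (.inl h)).1.1, (hb b (.inl h)).2⟩
      refine ⟨_, ?_, by rw [sem, branch_of_ne he]; exact .ite_true he e'⟩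
      simp only [cost]; omega
  | forTo b v p ih =>
    simp only [bounds, mods, List.mem_cons, not_or] at hb
    obtain ⟨⟨hbv, hbp⟩, hbX⟩ := hb b (.inl rfl)
    set N := s b 0 with hN
    have hframe : ∀ k a, a ≠ v → a ∉ p.mods → forSem p.sem v k s a = s a := fun k a h1 h2 =>
      forSem_frame h1 (fun s => sem_frame h2 s) k s
    have hrest : ∀ j k, k + j = N → ∃ T ≤ j * (p.cost X + 12) + 6,
        Exec (.loop (.sub (var b) (var v))
          (.seq p.toProgram (.write v (.const 0) (.add (var v) (.const 1)))))
          (forSem p.sem v k s) (forSem p.sem v N s) T := by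
      intro j
      induction j with
      | zero =>
        intro k hk
        obtain rfl : k = N := by simpa using hk
        refine ⟨6, by omega, .loop_done ?_⟩
        simp [Expr.eval, forSem_var, hframe _ _ hbv hbp, ← hN]
      | succ j ihj =>
        intro k hk
        obtain ⟨T₂, h₂, e₂⟩ := ihj (k + 1) (by omega)
        obtain ⟨T₁, h₁, e₁⟩ := ih hp.2 (s := forSem p.sem v k s) fun b' hb' => by
          obtain ⟨h3, h4⟩ := hb b' (.inr hb')
          exact ⟨h3.2, by rw [hframe _ _ h3.1 h3.2]; exact h4⟩
        have hv : p.sem (forSem p.sem v k s) v 0 = k := by rw [sem_frame hp.1, forSem_var]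
        have hw := Exec.write v (.const 0) (.add (var v) (.const 1)) (p.sem (forSem p.sem v k s))
        simp only [Expr.eval, hv] at hw
        refine ⟨_, ?_, .loop_step ?_ (.seq e₁ hw) e₂⟩
        · simp only [Expr.cost, Nat.succ_mul]; omega
        · simp only [Expr.eval, forSem_var, hframe _ _ hbv hbp, ← hN]; omega
    obtain ⟨T, h, e⟩ := hrest N 0 (by omega)
    refine ⟨_, ?_, .seq (.write v (.const 0) (.const 0) s) e⟩
    have := Nat.mul_le_mul_right (p.cost X + 12) hbX
    simp only [Expr.cost, cost]
    omega

-- Polynomial bounds in `n + 2`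

theorem add_le_pow {n a b i j : ℕ} (ha : a ≤ (n + 2) ^ i) (hb : b ≤ (n + 2) ^ j) :
    a + b ≤ (n + 2) ^ (i + j + 1) := by
  have h1 : a ≤ (n + 2) ^ (i + j) := ha.trans (Nat.pow_le_pow_right (by omega) (by omega))
  have h2 : b ≤ (n + 2) ^ (i + j) := hb.trans (Nat.pow_le_pow_right (by omega) (by omega))
  rw [pow_succ]
  nlinarith

theorem mul_le_pow {n a b i j : ℕ} (ha : a ≤ (n + 2) ^ i) (hb : b ≤ (n + 2) ^ j) :
    a * b ≤ (n + 2) ^ (i + j) := by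
  rw [pow_add]; exact Nat.mul_le_mul ha hb

theorem const_le_pow (n a : ℕ) : a ≤ (n + 2) ^ a :=
  (Nat.lt_two_pow_self).le.trans (Nat.pow_le_pow_left (by omega) a)

/-- The base `n + 2` is at least 2 even for `n = 0`, so constants and sums are absorbed by larger
exponents. The cube is chosen because the longest loop runs over `n * n * n` cells. -/
theorem exists_cost_le (p : Cmd) : ∃ c, ∀ n, p.cost ((n + 2) ^ 3) ≤ (n + 2) ^ c := by
  induction p with
  | skip => exact ⟨_, fun n => const_le_pow n 1⟩
  | write a i e => exact ⟨_, fun n => const_le_pow n _⟩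
  | seq p q ihp ihq =>
    obtain ⟨c, hc⟩ := ihp
    obtain ⟨d, hd⟩ := ihq
    exact ⟨_, fun n => add_le_pow (hc n) (hd n)⟩
  | ite e p q ihp ihq =>
    obtain ⟨c, hc⟩ := ihp
    obtain ⟨d, hd⟩ := ihq
    exact ⟨_, fun n => add_le_pow (const_le_pow n (e.cost + 1)) (add_le_pow (hc n) (hd n))⟩
  | forTo b v p ih =>
    obtain ⟨c, hc⟩ := ih
    exact ⟨_, fun n => add_le_pow (mul_le_pow le_rfl (add_le_pow (hc n) (const_le_pow n 12)))
      (const_le_pow n 9)⟩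

end Cmd

/-! ### Preprocessing

The arrays of the program are: `0`, `1`, `2` the input; `3`, `4`, `5` the output; `6` and `7` hold
`n ^ 2` and `n ^ 3`; `8` the table of multiples of `n`; `9` marks the non-isolated vertices and
`10` holds their number; `11` holds the number of rows of array `5` in use, and `12` marks the
cells of array `5` that are in use; `13`, `14`, `15` hold the removed vertices, the vertex
ordering and its inverse; `16` holds the remaining budget; from `20` on, local variables. -/

open Cmd

/-- Compute `n ^ 2`. -/
def squareCmd : Cmd := forTo 0 20 (assign 6 (.add (var 6) (var 0)))

theorem squareCmd_spec {s : Store} (h : s 6 0 = 0) : squareCmd.sem s 6 0 = s 0 0 * s 0 0 := by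
  refine sem_forTo_induction (fun k s' => s' 6 0 = k * s 0 0) (by simp [Store.set_apply, h]) ?_
  intro k hk s' hv hf hI
  have h0 : s' 0 = s 0 := hf 0 (by decide)
  simp [sem, Expr.eval, Store.set_apply, hI, h0, Nat.succ_mul]

/-- Tabulate the multiples of `n` up to `n ^ 2 * n`, and store the last one. -/
def multiplesCmd : Cmd :=
  .seq (forTo 6 20 (.write 8 (.add (var 20) (.const 1)) (.add (.read 8 (var 20)) (var 0))))
    (assign 7 (.read 8 (var 6)))

/-- The machine cannot multiply, so the offset of row `l` of a matrix is looked up in this table. It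
must reach `n * n`, the largest number of rows that array `5` may need. -/
theorem multiplesCmd_spec {s : Store} (h : s 8 0 = 0) :
    (∀ l ≤ s 6 0, multiplesCmd.sem s 8 l = l * s 0 0) ∧
      multiplesCmd.sem s 7 0 = s 6 0 * s 0 0 := by
  have key := sem_forTo_induction (b := 6) (v := 20)
    (p := .write 8 (.add (var 20) (.const 1)) (.add (.read 8 (var 20)) (var 0))) (s := s)
    (fun k s' => ∀ l ≤ k, s' 8 l = l * s 0 0) (by simp [Store.set_apply, h]) (by
      intro k hk s' hv hf hI l hl
      have h0 : s' 0 = s 0 := hf 0 (by decide)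
      by_cases hlk : l = k + 1
      · simp [sem, Expr.eval, Store.set_apply, hI, h0, hlk, Nat.succ_mul, hv]
      · simpa [sem, Expr.eval, Store.set_apply, h0, hlk, hv] using hI l (by omega))
  have h6 : (forTo 6 20 (.write 8 (.add (var 20) (.const 1))
      (.add (.read 8 (var 20)) (var 0)))).sem s 6 = s 6 := sem_frame (by decide) s
  constructor
  · intro l hl
    rw [multiplesCmd, sem_seq, sem_write, Store.set_of_ne (by decide)]
    exact key l hl
  · simp only [multiplesCmd, sem_seq, sem_write, Store.set_apply, and_self, if_true, Expr.eval, h6]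
    exact key _ le_rfl

/-- Compute the number of rows. -/
def rowsCmd : Cmd :=
  forTo 6 20 (cond (.sub (var 1) (.add (.const 1) (.add (var 11) (var 11))))
    (assign 11 (.add (var 11) (.const 1))))

/-- Halving without division: the counter `c` advances as long as `1 + 2 * c < t`, that is, `c + 1 ≤
t / 2`. Running `n * n` rounds rather than `t` keeps the time independent of `t`. -/
theorem rowsCmd_spec {s : Store} (h : s 11 0 = 0) :
    rowsCmd.sem s 11 0 = min (s 6 0) (s 1 0 / 2) := by
  refine sem_forTo_induction (fun k s' => s' 11 0 = min k (s 1 0 / 2))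
    (by simp [Store.set_apply, h]) ?_
  intro k hk s' hv hf hI
  have h1 : s' 1 = s 1 := hf 1 (by decide)
  simp only [sem, Expr.eval, h1, hI]
  rw [Store.set_of_ne (by decide)]
  rw [branch]
  split_ifs with h2
  · rw [hI]; omega
  · simp only [Store.set_apply, and_self, if_true]; omega

/-- Mark and count the non-isolated vertices. -/
def activeCmd : Cmd :=
  forTo 0 20 (.seq
    (forTo 0 21 (cond (.read 2 (.add (.read 8 (var 20)) (var 21)))
      (.write 9 (var 20) (.const 1))))
    (assign 10 (.add (var 10) (.read 9 (var 20)))))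

open Classical in
/-- The indicator of the non-isolated vertices. -/
noncomputable def activeVal (n : ℕ) (A : ℕ → ℕ) (v : ℕ) : ℕ :=
  if v < n ∧ ∃ w < n, A (v * n + w) ≠ 0 then 1 else 0

open Classical in
theorem activeCmd_spec {s : Store} (h9 : ∀ v, s 9 v = 0) (h10 : s 10 0 = 0)
    (h8 : ∀ v < s 0 0, s 8 v = v * s 0 0) :
    (∀ v, activeCmd.sem s 9 v = activeVal (s 0 0) (s 2) v) ∧
      activeCmd.sem s 10 0 = ∑ v ∈ Finset.range (s 0 0), activeVal (s 0 0) (s 2) v := by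
  set n := s 0 0 with hn
  refine sem_forTo_induction (fun k s' => (∀ v, s' 9 v = if v < k then activeVal n (s 2) v else 0) ∧
    s' 10 0 = ∑ v ∈ Finset.range k, activeVal n (s 2) v) (by simp [Store.set_apply, h9, h10]) ?_
    |> fun h => ⟨fun v => ?_, h.2⟩
  · intro k hk s' hv hf ⟨hI1, hI2⟩
    have e0 : s' 0 = s 0 := hf 0 (by decide)
    have e2 : s' 2 = s 2 := hf 2 (by decide)
    have e8 : s' 8 = s 8 := hf 8 (by decide)
    have inner := sem_forTo_induction (b := 0) (v := 21)
      (p := cond (.read 2 (.add (.read 8 (var 20)) (var 21))) (.write 9 (var 20) (.const 1)))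
      -- Vertex `k` is marked as soon as one of its first `j` matrix entries is nonzero; for `j = n`
      -- this is `activeVal`.
      (s := s') (fun j s'' => ∀ v, s'' 9 v = if v < k then activeVal n (s 2) v else
          if v = k ∧ ∃ w < j, s 2 (k * n + w) ≠ 0 then 1 else 0)
      (by intro v; simp [Store.set_apply, hI1]) (by
        intro j hj s'' hv' hf' hI v
        have e2' : s'' 2 = s 2 := (hf' 2 (by decide)).trans e2
        have e8' : s'' 8 = s 8 := (hf' 8 (by decide)).trans e8
        have e20 : s'' 20 = s' 20 := hf' 20 (by decide)
        simp only [sem, Expr.eval, e2', e8', e20, hv, hv', h8 k hk]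
        have hex : (∃ w < j + 1, s 2 (k * n + w) ≠ 0) ↔
            (∃ w < j, s 2 (k * n + w) ≠ 0) ∨ s 2 (k * n + j) ≠ 0 := by
          simp only [Nat.lt_succ_iff_lt_or_eq, or_and_right, exists_or, exists_eq_left]
        simp only [hex]
        by_cases h2 : s 2 (k * n + j) ≠ 0
        · rw [branch_of_ne h2, Store.set_of_ne (by decide), Store.set_apply]
          by_cases hvk : v = k
          · simp [hvk, h2]
          · simp [hvk, hI v]
        · rw [branch_of_eq (not_not.1 h2), Store.set_of_ne (by decide), hI v]
          simp [h2])
    rw [e0, ← hn] at inner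
    rw [← hn] at hk
    generalize hs2 : (forTo 0 21 (cond (.read 2 (.add (.read 8 (var 20)) (var 21)))
      (.write 9 (var 20) (.const 1)))).sem s' = s2 at inner
    have e10 : s2 10 = s' 10 := by rw [← hs2]; exact sem_frame (by decide) _
    have e20 : s2 20 = s' 20 := by rw [← hs2]; exact sem_frame (by decide) _
    have hval : ∀ v, s2 9 v = if v < k + 1 then activeVal n (s 2) v else 0 := by
      intro v
      rw [inner v]
      rcases lt_trichotomy v k with h | rfl | h
      · simp [h, h.trans (Nat.lt_succ_self k)]
      · simp [activeVal, hk]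
      · simp [h.not_gt, h.ne', show ¬ v < k + 1 by omega]
    rw [sem, hs2]
    constructor
    · intro v
      simpa [sem, Store.set_apply] using hval v
    · simp [sem, Store.set_apply, Expr.eval, e10, hI2, e20, hv, hval, Finset.sum_range_succ]
  · have := h.1 v
    rw [activeCmd, this]
    split_ifs with hvn
    · rfl
    · simp only [activeVal]
      rw [if_neg (fun h => hvn h.1)]

/-- Mark the cells in use. -/
def cellsCmd : Cmd :=
  forTo 11 20 (forTo 0 21 (.write 12 (.add (.read 8 (var 20)) (var 21)) (.read 9 (var 21))))

/-- Cell `i` belongs to row `i / n` and column `i % n`. The condition `i % n < n` matters only for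
`n = 0`, where no cell is in use. -/
theorem cellsCmd_spec {s : Store} (h12 : ∀ i, s 12 i = 0)
    (h8 : ∀ l < s 11 0, s 8 l = l * s 0 0) (i : ℕ) :
    cellsCmd.sem s 12 i = if i / s 0 0 < s 11 0 ∧ i % s 0 0 < s 0 0 then s 9 (i % s 0 0) else 0 := by
  set n := s 0 0 with hn
  refine sem_forTo_induction
    (fun k s' => ∀ i, s' 12 i = if i / n < k ∧ i % n < n then s 9 (i % n) else 0)
    (by simp [Store.set_apply, h12]) ?_ i
  intro k hk s' hv hf hI i
  have e0 : s' 0 = s 0 := hf 0 (by decide)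
  have e9 : s' 9 = s 9 := hf 9 (by decide)
  have e8 : s' 8 = s 8 := hf 8 (by decide)
  have inner := sem_forTo_induction (b := 0) (v := 21)
    (p := .write 12 (.add (.read 8 (var 20)) (var 21)) (.read 9 (var 21)))
    (s := s') (fun j s'' => ∀ i, s'' 12 i =
      if (i / n < k ∧ i % n < n) ∨ (i / n = k ∧ i % n < j) then s 9 (i % n) else 0)
    (by intro v; simp [Store.set_apply, hI]) (by
      intro j hj s'' hv' hf' hI' i
      have e9' : s'' 9 = s 9 := (hf' 9 (by decide)).trans e9
      have e8' : s'' 8 = s 8 := (hf' 8 (by decide)).trans e8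
      have e20 : s'' 20 = s' 20 := hf' 20 (by decide)
      rw [e0, ← hn] at hj
      have hn0 : 0 < n := by omega
      simp only [sem, Expr.eval, e9', e8', e20, hv, hv', h8 k hk]
      rw [Store.set_of_ne (by decide), Store.set_apply, hI' i]
      by_cases hi : i = k * n + j
      · have h1 : i / n = k := by
          rw [hi, mul_comm, Nat.mul_add_div hn0, Nat.div_eq_of_lt hj, add_zero]
        have h2 : i % n = j := by rw [hi, mul_comm, Nat.mul_add_mod, Nat.mod_eq_of_lt hj]
        simp [h1, h2, hi.symm]
      · have h3 : ¬ (i / n = k ∧ i % n = j) := by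
          rintro ⟨h1, h2⟩
          apply hi
          rw [← h1, ← h2, mul_comm]
          exact (Nat.div_add_mod i n).symm
        have h4 : ((i / n < k ∧ i % n < n) ∨ (i / n = k ∧ i % n < j)) ↔
            ((i / n < k ∧ i % n < n) ∨ (i / n = k ∧ i % n < j + 1)) := by omega
        simp only [hi, and_false, if_false, h4])
  rw [e0, ← hn] at inner
  rw [Store.set_of_ne (by decide), inner i]
  have : ((i / n < k ∧ i % n < n) ∨ (i / n = k ∧ i % n < n)) ↔ (i / n < k + 1 ∧ i % n < n) := by
    omega
  simp only [this]

/-! ### Computing a degeneracy ordering -/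

/-- The number of neighbours of `v` outside of `R`, for an adjacency matrix `A`. -/
def degOutside (n : ℕ) (A : ℕ → ℕ) (R : ℕ → Prop) [DecidablePred R] (v : ℕ) : ℕ :=
  ((Finset.range n).filter fun w => ¬ R w ∧ A (v * n + w) ≠ 0).card

/-- Compute the number of neighbours of vertex `21` that have not been removed. -/
def degreeCmd : Cmd :=
  .seq (assign 24 (.const 0)) (forTo 0 23 (condZero (.read 13 (var 23))
    (cond (.read 2 (.add (.read 8 (var 21)) (var 23))) (assign 24 (.add (var 24) (.const 1))))))

theorem degreeCmd_spec {s : Store} (h8 : s 8 (s 21 0) = s 21 0 * s 0 0) :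
    degreeCmd.sem s 24 0 = degOutside (s 0 0) (s 2) (fun w => s 13 w ≠ 0) (s 21 0) := by
  rw [degreeCmd, sem_seq, degOutside]
  set s₁ := (assign 24 (.const 0)).sem s with hs₁
  have e : ∀ a, a ≠ 24 → s₁ a = s a := fun a ha => sem_frame (by simpa [mods] using ha) s
  rw [← e 0 (by decide), ← e 2 (by decide), ← e 13 (by decide), ← e 21 (by decide)]
  refine sem_forTo_induction (fun k s' => s' 24 0 = ((Finset.range k).filter fun w =>
    ¬ (s₁ 13 w ≠ 0) ∧ s₁ 2 (s₁ 21 0 * s₁ 0 0 + w) ≠ 0).card) ?_ ?_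
  · simp [hs₁, sem, Store.set_apply, Expr.eval]
  intro k hk s' hv hf hI
  rw [Store.set_of_ne (by decide), Finset.range_add_one, Finset.filter_insert]
  simp only [sem, Expr.eval, hv, hf 13 (by decide), hf 21 (by decide), hf 2 (by decide),
    hf 8 (by decide)]
  rw [show s₁ 8 (s₁ 21 0) = s₁ 21 0 * s₁ 0 0 by
    rw [e 8 (by decide), e 21 (by decide), e 0 (by decide), h8]]
  by_cases h1 : s₁ 13 k ≠ 0
  · rw [branch_of_ne h1, if_neg (fun h => h.1 h1), hI]
  by_cases h2 : s₁ 2 (s₁ 21 0 * s₁ 0 0 + k) ≠ 0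
  · rw [branch_of_eq (not_not.1 h1), branch_of_ne h2, if_pos ⟨h1, h2⟩, Finset.card_insert_of_notMem (by simp),
      Store.set_apply, if_pos ⟨rfl, rfl⟩, hI]
  · rw [branch_of_eq (not_not.1 h1), branch_of_eq (not_not.1 h2), if_neg (fun h => h2 h.2), hI]

/-- Find a vertex of minimum degree among those that have not been removed. -/
def minDegreeCmd : Cmd :=
  .seq (assign 22 (.add (var 0) (.const 1))) (forTo 0 21 (condZero (.read 13 (var 21))
    (.seq degreeCmd (cond (.sub (var 22) (var 24))
      (.seq (assign 22 (var 24)) (assign 25 (var 21)))))))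

theorem minDegreeCmd_spec {s : Store} (h8 : ∀ v < s 0 0, s 8 v = v * s 0 0)
    (hex : ∃ v < s 0 0, s 13 v = 0) :
    minDegreeCmd.sem s 25 0 < s 0 0 ∧ s 13 (minDegreeCmd.sem s 25 0) = 0 ∧
      ∀ v < s 0 0, s 13 v = 0 →
        degOutside (s 0 0) (s 2) (fun w => s 13 w ≠ 0) (minDegreeCmd.sem s 25 0) ≤
          degOutside (s 0 0) (s 2) (fun w => s 13 w ≠ 0) v := by
  rw [minDegreeCmd, sem_seq]
  set s₁ := (assign 22 (.add (var 0) (.const 1))).sem s with hs₁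
  have e : ∀ a, a ≠ 22 → s₁ a = s a := fun a ha => sem_frame (by simpa [mods] using ha) s
  rw [← e 0 (by decide), ← e 2 (by decide), ← e 13 (by decide)] at *
  set n := s₁ 0 0 with hn
  set D := degOutside n (s₁ 2) (fun w => s₁ 13 w ≠ 0) with hD
  -- The initial value `n + 1` of the running minimum exceeds every degree, so the first surviving
  -- vertex is always recorded.
  have hDn : ∀ v, D v < n + 1 := fun v =>
    Nat.lt_succ_of_le ((Finset.card_filter_le _ _).trans_eq (Finset.card_range n))
  have key := sem_forTo_induction (b := 0) (v := 21) (s := s₁)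
    (p := condZero (.read 13 (var 21)) (.seq degreeCmd (cond (.sub (var 22) (var 24))
      (.seq (assign 22 (var 24)) (assign 25 (var 21))))))
    (fun k s' => (∀ v < k, s₁ 13 v = 0 → s' 22 0 ≤ D v) ∧
      (s' 22 0 < n + 1 → s' 25 0 < n ∧ s₁ 13 (s' 25 0) = 0 ∧ D (s' 25 0) = s' 22 0)) (by
      simp [Store.set_apply, hs₁, sem, Expr.eval, hn]) (by
      intro k hk s' hv hf ⟨hI1, hI2⟩
      have f0 : s' 0 = s₁ 0 := hf 0 (by decide)
      have f2 : s' 2 = s₁ 2 := hf 2 (by decide)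
      have f13 : s' 13 = s₁ 13 := hf 13 (by decide)
      have f8 : s' 8 = s 8 := (hf 8 (by decide)).trans (e 8 (by decide))
      have hdeg := degreeCmd_spec (s := s') (by rw [hv, f8, f0, h8 k hk])
      rw [hv, f0, f2, ← hn] at hdeg
      simp only [f13, ← hD] at hdeg
      have g : ∀ a, a ∉ degreeCmd.mods → degreeCmd.sem s' a = s' a := fun a ha => sem_frame ha s'
      rw [Store.set_of_ne (by decide), Store.set_of_ne (by decide)]
      simp only [sem_ite, sem_seq, sem_skip, sem_write, Expr.eval, hdeg, hv, f13,
        g 22 (by decide)]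
      by_cases h1 : s₁ 13 k = 0
      · by_cases h2 : s' 22 0 - D k = 0
        · simp only [h1, h2, branch_zero, g 22 (by decide), g 25 (by decide)]
          refine ⟨fun v hvk hdv => ?_, hI2⟩
          rcases Nat.lt_succ_iff_lt_or_eq.1 hvk with h | rfl
          · exact hI1 v h hdv
          · omega
        · simp only [h1, branch_zero, branch_of_ne h2, Store.set_apply, and_true,
            g 21 (by decide), hv]
          simp only [show ¬ (22 = 25) by decide, show ¬ (21 = 22) by decide, if_false, if_true,
            h1, and_true]
          refine ⟨fun v hvk hdv => ?_, fun _ => hk⟩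
          rcases Nat.lt_succ_iff_lt_or_eq.1 hvk with h | rfl
          · have := hI1 v h hdv; omega
          · exact le_rfl
      · simp only [branch_of_ne h1]
        refine ⟨fun v hvk hdv => ?_, hI2⟩
        rcases Nat.lt_succ_iff_lt_or_eq.1 hvk with h | rfl
        · exact hI1 v h hdv
        · exact absurd hdv h1)
  rw [← hn] at key
  obtain ⟨v, hv, hdv⟩ := hex
  obtain ⟨h1, h2⟩ := key
  obtain ⟨h3, h4, h5⟩ := h2 ((h1 v hv hdv).trans_lt (hDn v))
  exact ⟨h3, h4, fun w hw hdw => h5.trans_le (h1 w hw hdw)⟩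

/-- The first `k` vertices of an ordering that results from removing vertices of minimum degree;
`pos` is the inverse of `ord`, and `dead` marks the removed vertices. -/
structure IsElimination (n : ℕ) (A : ℕ → ℕ) (k : ℕ) (dead ord pos : ℕ → ℕ) : Prop where
  lt : ∀ i < k, ord i < n
  inj : ∀ i < k, ∀ j < k, ord i = ord j → i = j
  dead_iff : ∀ v, dead v ≠ 0 ↔ ∃ i < k, ord i = v
  pos_ord : ∀ i < k, pos (ord i) = i
  le : ∀ i < k, ∀ v < n, (¬ ∃ j < i, ord j = v) →
    degOutside n A (fun w => ∃ j < i, ord j = w) (ord i) ≤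
      degOutside n A (fun w => ∃ j < i, ord j = w) v

theorem degOutside_congr {n : ℕ} {A : ℕ → ℕ} {R R' : ℕ → Prop} [DecidablePred R]
    [DecidablePred R'] (h : ∀ w, R w ↔ R' w) (v : ℕ) :
    degOutside n A R v = degOutside n A R' v := by
  simp only [degOutside, h]

theorem IsElimination.succ {n : ℕ} {A : ℕ → ℕ} {k : ℕ} {dead ord pos dead' ord' pos' : ℕ → ℕ}
    (h : IsElimination n A k dead ord pos) {b : ℕ} (hb : b < n) (hdb : dead b = 0)
    (hle : ∀ v < n, dead v = 0 →
      degOutside n A (fun w => dead w ≠ 0) b ≤ degOutside n A (fun w => dead w ≠ 0) v)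
    (hd : ∀ v, dead' v = if v = b then 1 else dead v)
    (ho : ∀ i, ord' i = if i = k then b else ord i)
    (hp : ∀ v, pos' v = if v = b then k else pos v) :
    IsElimination n A (k + 1) dead' ord' pos' := by
  have hne : ∀ i < k, ord i ≠ b := fun i hi hib => (h.dead_iff b).2 ⟨i, hi, hib⟩ hdb
  have hok : ord' k = b := by simp [ho]
  have hol : ∀ i < k, ord' i = ord i := fun i hi => by simp [ho, hi.ne]
  -- Writing at position `k` leaves all prefixes of length at most `k` as they were, so the earlier
  -- minimality statements persist.
  have hset : ∀ i ≤ k, ∀ w, (∃ j < i, ord' j = w) ↔ ∃ j < i, ord j = w := fun i hi w =>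
    exists_congr fun j => and_congr_right fun hj => by rw [hol j (by omega)]
  refine ⟨?_, ?_, ?_, ?_, ?_⟩
  · intro i hi
    rcases Nat.lt_succ_iff_lt_or_eq.1 hi with hi | rfl
    · rw [hol i hi]; exact h.lt i hi
    · rwa [hok]
  · intro i hi j hj hij
    rcases Nat.lt_succ_iff_lt_or_eq.1 hi with hi | rfl <;>
      rcases Nat.lt_succ_iff_lt_or_eq.1 hj with hj | rfl
    · rw [hol i hi, hol j hj] at hij; exact h.inj i hi j hj hij
    · rw [hol i hi, hok] at hij; exact absurd hij (hne i hi)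
    · rw [hol j hj, hok] at hij; exact absurd hij.symm (hne j hj)
    · rfl
  · intro v
    simp only [Nat.lt_succ_iff_lt_or_eq, or_and_right, exists_or, exists_eq_left, hok,
      hset k le_rfl, ← h.dead_iff v, hd]
    by_cases hv : v = b
    · simp [hv]
    · simp [hv, Ne.symm hv]
  · intro i hi
    rcases Nat.lt_succ_iff_lt_or_eq.1 hi with hi | rfl
    · rw [hol i hi, hp, if_neg (hne i hi)]; exact h.pos_ord i hi
    · rw [hok, hp, if_pos rfl]
  · intro i hi v hv hnv
    have hik : i ≤ k := by omega
    rw [hset i hik] at hnv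
    rw [degOutside_congr (hset i hik), degOutside_congr (hset i hik)]
    rcases Nat.lt_succ_iff_lt_or_eq.1 hi with hi | rfl
    · rw [hol i hi]; exact h.le i hi v hv hnv
    · rw [hok, ← degOutside_congr h.dead_iff, ← degOutside_congr h.dead_iff]
      exact hle v hv (by simpa using fun h' => hnv ((h.dead_iff v).1 h'))

/-- Compute an ordering by repeated removal of a vertex of minimum degree. -/
def orderCmd : Cmd :=
  forTo 0 20 (.seq minDegreeCmd (.seq (.write 14 (var 20) (var 25))
    (.seq (.write 15 (var 25) (var 20)) (.write 13 (var 25) (.const 1)))))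

theorem orderCmd_spec {s : Store} (h8 : ∀ v < s 0 0, s 8 v = v * s 0 0)
    (h13 : ∀ v, s 13 v = 0) :
    IsElimination (s 0 0) (s 2) (s 0 0) (orderCmd.sem s 13) (orderCmd.sem s 14)
      (orderCmd.sem s 15) := by
  refine sem_forTo_induction (fun k s' => IsElimination (s 0 0) (s 2) k (s' 13) (s' 14) (s' 15))
    ?_ ?_
  · constructor <;> simp [Store.set_apply, h13]
  intro k hk s' hv hf hI
  have f0 : s' 0 = s 0 := hf 0 (by decide)
  have f2 : s' 2 = s 2 := hf 2 (by decide)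
  have f8 : s' 8 = s 8 := hf 8 (by decide)
  -- Only `k < n` vertices have been removed, so one survives.
  have hex : ∃ v < s' 0 0, s' 13 v = 0 := by
    by_contra! hcon
    rw [f0] at hcon
    have : Finset.range (s 0 0) ⊆ (Finset.range k).image (s' 14) := by
      intro v hv
      obtain ⟨i, hi, rfl⟩ := (hI.dead_iff v).1 (hcon v (Finset.mem_range.1 hv))
      exact Finset.mem_image_of_mem _ (Finset.mem_range.2 hi)
    have := (Finset.card_le_card this).trans Finset.card_image_le
    simp at this
    omega
  have hmin := minDegreeCmd_spec (s := s') (by rw [f0, f8]; exact h8) hex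
  have g : ∀ a, a ∉ minDegreeCmd.mods → minDegreeCmd.sem s' a = s' a := fun a ha =>
    sem_frame ha s'
  obtain ⟨h1, h2, h3⟩ := hmin
  rw [f0, f2] at h3
  rw [f0] at h1
  rw [Store.set_of_ne (by decide), Store.set_of_ne (by decide), Store.set_of_ne (by decide)]
  refine hI.succ h1 h2 h3 ?_ ?_ ?_ <;> intro i <;>
    simp [sem_seq, sem_write, Expr.eval, Store.set_apply, g 13 (by decide), g 14 (by decide),
      g 15 (by decide), g 20 (by decide), hv]

/-- The set in the definition contains `n`, so its infimum is attained and is not the default value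
of `sInf ∅`. -/
theorem degeneracy_spec {n : ℕ} (G : SimpleGraph (Fin n)) (H : G.Subgraph)
    (hH : H.verts.Nonempty) : ∃ v ∈ H.verts, (H.neighborSet v).ncard ≤ degeneracy G := by
  refine Nat.sInf_mem (s := {d : ℕ | ∀ H : G.Subgraph, H.verts.Nonempty →
    ∃ v ∈ H.verts, (H.neighborSet v).ncard ≤ d}) ⟨n, fun H hH => ?_⟩ H hH
  obtain ⟨v, hv⟩ := hH
  refine ⟨v, hv, (Set.ncard_le_ncard (Set.subset_univ _) Set.finite_univ).trans ?_⟩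
  simp [Set.ncard_univ]

/-- When `x` is removed, the subgraph induced on the surviving vertices has some vertex of degree at
most the degeneracy. As `x` has minimum degree there, its degree, which counts its later neighbours,
is no larger. -/
theorem IsElimination.exists_ordering {n : ℕ} {G : SimpleGraph (Fin n)} {A : ℕ → ℕ}
    {dead ord pos : ℕ → ℕ} (h : IsElimination n A n dead ord pos)
    (hA : ∀ u v : Fin n, A (u * n + v) ≠ 0 ↔ G.Adj u v) :
    ∃ σ : Fin n ≃ Fin n, IsDegeneracyOrdering G σ ∧ (∀ p : Fin n, ord p = σ.symm p) ∧
      ∀ v : Fin n, pos v = σ v := by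
  let f : Fin n → Fin n := fun p => ⟨ord p, h.lt p p.2⟩
  have hf : Function.Injective f := fun i j hij =>
    Fin.ext (h.inj i i.2 j j.2 (congrArg Fin.val hij))
  let τ : Fin n ≃ Fin n := Equiv.ofBijective f (Finite.injective_iff_bijective.1 hf)
  have hτ : ∀ p, (τ p : ℕ) = ord p := fun p => rfl
  have hR : ∀ (i : Fin n) (w : Fin n), (∃ j < (i : ℕ), ord j = w) ↔ τ.symm w < i := by
    intro i w
    constructor
    · rintro ⟨j, hj, hjw⟩
      have : τ ⟨j, hj.trans i.2⟩ = w := Fin.ext hjw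
      rw [← this]
      rw [Equiv.symm_apply_apply]
      exact hj
    · intro hw
      exact ⟨τ.symm w, hw, by rw [← hτ]; simp⟩
  have hdeg : ∀ i v : Fin n, degOutside n A (fun w => ∃ j < (i : ℕ), ord j = w) v =
      {w : Fin n | i ≤ τ.symm w ∧ G.Adj v w}.ncard := by
    intro i v
    rw [degOutside, ← Set.ncard_coe_finset]
    refine (Set.ncard_congr (fun (w : Fin n) _ => (w : ℕ)) ?_ ?_ ?_).symm
    · intro w hw
      simp only [Finset.coe_filter, Finset.mem_range, Set.mem_ofPred_eq]
      exact ⟨w.2, by rw [hR]; exact not_lt.2 hw.1, (hA v w).2 hw.2⟩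
    · intro a b _ _ hab
      exact Fin.ext hab
    · intro w hw
      simp only [Finset.coe_filter, Finset.mem_range, Set.mem_ofPred_eq] at hw
      refine ⟨⟨w, hw.1⟩, ⟨?_, (hA v ⟨w, hw.1⟩).1 hw.2.2⟩, rfl⟩
      exact not_lt.1 fun h' => hw.2.1 ((hR i ⟨w, hw.1⟩).2 h')
  refine ⟨τ.symm, ?_, fun p => rfl, fun v => ?_⟩
  · intro x
    set i := τ.symm x with hi
    have hx : (x : ℕ) = ord i := by rw [← hτ]; simp [hi]
    -- The survivors at the removal of `x` are the vertices from position `i` on, including `x`,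
    -- which makes the subgraph nonempty.
    obtain ⟨v, hv, hvd⟩ := degeneracy_spec G ((⊤ : G.Subgraph).induce {w | i ≤ τ.symm w})
      ⟨x, by simp [hi]⟩
    have h1 := h.le i i.2 v v.2 (by rw [hR]; exact not_lt.2 hv)
    rw [← hx, hdeg, hdeg] at h1
    calc (laterNbrs G τ.symm x).ncard ≤ {w : Fin n | i ≤ τ.symm w ∧ G.Adj x w}.ncard :=
          Set.ncard_le_ncard (fun w hw => ⟨hw.2.le, hw.1⟩) (Set.toFinite _)
      _ ≤ {w : Fin n | i ≤ τ.symm w ∧ G.Adj v w}.ncard := h1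
      _ ≤ (((⊤ : G.Subgraph).induce {w | i ≤ τ.symm w}).neighborSet v).ncard :=
          Set.ncard_le_ncard (fun w hw => ⟨hv, hw.1, hw.2⟩) (Set.toFinite _)
      _ ≤ degeneracy G := hvd
  · have : ord (τ.symm v) = v := by rw [← hτ]; simp
    conv_lhs => rw [← this]
    exact h.pos_ord _ (τ.symm v).2

/-! ### The lexicographic degeneracy edge permutation -/

section DepList

variable {n : ℕ}

open Classical in
/-- The degeneracy edge permutation that lists the later neighbours of a vertex in increasing
order. -/
noncomputable def depList (G : SimpleGraph (Fin n)) (σ : Fin n ≃ Fin n) :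
    List (Fin n × Fin n) :=
  (List.finRange n).flatMap fun p =>
    ((List.finRange n).filter fun y => y ∈ laterNbrs G σ (σ.symm p)).map fun y => (σ.symm p, y)

theorem isDEP_depList (G : SimpleGraph (Fin n)) (σ : Fin n ≃ Fin n) :
    IsDEP G σ (depList G σ) := by
  classical
  refine ⟨fun x => (List.finRange n).filter fun y => y ∈ laterNbrs G σ x, fun x => ⟨?_, ?_⟩, ?_⟩
  · exact (List.nodup_finRange n).filter _
  · intro y; simp
  · simp only [depList]

theorem find?_eq_some_of_pairwise {α : Type*} {R : α → α → Prop} {l : List α}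
    (hl : l.Pairwise R) {q : α → Bool} {e : α} (he : e ∈ l) (hq : q e)
    (hlt : ∀ a ∈ l, R a e → q a = false) : l.find? q = some e := by
  induction l with
  | nil => simp at he
  | cons a l ih =>
    rw [List.pairwise_cons] at hl
    rcases List.mem_cons.1 he with rfl | he
    · simp [hq]
    · rw [List.find?_cons, hlt a (by simp) (hl.1 e he)]
      exact ih hl.2 he fun b hb => hlt b (by simp [hb])

/-- The pair `(a, b)` comes before `(p, y)`, where vertices in first position are compared by
their position in the ordering `σ`. -/
def Before (σ : Fin n ≃ Fin n) (p y : ℕ) (a b : Fin n) : Prop :=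
  (σ a : ℕ) < p ∨ (σ a : ℕ) = p ∧ (b : ℕ) < y

/-- This replaces the restart at every call by a single scan: covered pairs stay covered, so the
next uncovered edge that a double loop over positions and vertices meets is the first uncovered edge
of the list. -/
theorem firstUncovered_depList_eq_some {G : SimpleGraph (Fin n)} {σ : Fin n ≃ Fin n}
    {C : Finset (Finset (Fin n))} {x y : Fin n} (hxy : y ∈ laterNbrs G σ x)
    (hC : ¬ Covered C x y)
    (hlt : ∀ a b, b ∈ laterNbrs G σ a → Before σ (σ x) y a b → Covered C a b) :
    firstUncovered (depList G σ) C = some (x, y) := by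
  refine find?_eq_some_of_pairwise (R := fun e e' => Before σ (σ e'.1) e'.2 e.1 e.2) ?_
    (((isDEP_depList G σ).mem_iff x y).2 hxy) (by simpa using hC) ?_
  · rw [depList, List.pairwise_flatMap]
    constructor
    · intro p _
      rw [List.pairwise_map]
      refine ((List.pairwise_lt_finRange n).filter _).imp ?_
      intro a b hab
      exact .inr ⟨rfl, hab⟩
    · refine (List.pairwise_lt_finRange n).imp ?_
      intro i j hij e he e' he'
      obtain ⟨_, _, rfl⟩ := List.mem_map.1 he
      obtain ⟨_, _, rfl⟩ := List.mem_map.1 he'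
      exact .inl (by simpa using hij)
  · rintro ⟨a, b⟩ hab h
    simpa using hlt a b (((isDEP_depList G σ).mem_iff a b).1 hab) h

end DepList

/-! ### Checking whether the rows of array `5` describe a path of the search -/

/-- The set of vertices in row `l` of a membership matrix. -/
def rowSet (n : ℕ) (b : ℕ → ℕ) (l : ℕ) : Finset (Fin n) :=
  Finset.univ.filter fun v : Fin n => b (l * n + v.val) ≠ 0

/-- The first `k` rows of a membership matrix. -/
def rowFamily (n : ℕ) (b : ℕ → ℕ) (k : ℕ) : Finset (Finset (Fin n)) :=
  (Finset.range k).image (rowSet n b)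

theorem rowFamily_succ (n : ℕ) (b : ℕ → ℕ) (k : ℕ) :
    rowFamily n b (k + 1) = insert (rowSet n b k) (rowFamily n b k) := by
  rw [rowFamily, Finset.range_add_one, Finset.image_insert, rowFamily]

theorem mem_rowSet {n : ℕ} {b : ℕ → ℕ} {l : ℕ} {v : Fin n} :
    v ∈ rowSet n b l ↔ b (l * n + v) ≠ 0 := by simp [rowSet]

theorem covered_rowFamily {n : ℕ} {b : ℕ → ℕ} {k : ℕ} {x y : Fin n} :
    Covered (rowFamily n b k) x y ↔ ∃ l < k, b (l * n + x) ≠ 0 ∧ b (l * n + y) ≠ 0 := by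
  simp [Covered, rowFamily, rowSet]

section Step

variable {n : ℕ} (G : SimpleGraph (Fin n)) (σ : Fin n ≃ Fin n) (L : ℕ) (b : ℕ → ℕ)

/-- Row `k` may be used for the edge `{x, y}` if the remaining budget is `r`. -/
def RowValid (x y : Fin n) (k r : ℕ) : Prop :=
  k < L ∧ IsCandidate G σ x y (rowSet n b k) ∧ (rowSet n b k).card ≤ r

open Classical in
/-- The effect of an edge on a flag for success, the number of used rows and the budget. -/
noncomputable def edgeStep (x y : Fin n) (q : ℕ × ℕ × ℕ) : ℕ × ℕ × ℕ :=
  if y ∈ laterNbrs G σ x ∧ ¬ Covered (rowFamily n b q.2.1) x y then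
    if RowValid G σ L b x y q.2.1 q.2.2 then
      (q.1, q.2.1 + 1, q.2.2 - (rowSet n b q.2.1).card)
    else (0, q.2.1, q.2.2)
  else q

variable {G σ L b}

theorem edgeStep_le {x y : Fin n} {q : ℕ × ℕ × ℕ} (hq : q.2.1 ≤ L) :
    (edgeStep G σ L b x y q).2.1 ≤ L := by
  rw [edgeStep]
  split_ifs with h1 h2
  · exact h2.1
  · exact hq
  · exact hq

theorem covered_before_succ {C : Finset (Finset (Fin n))} {p y : ℕ} {x z : Fin n}
    (hp : (σ x : ℕ) = p) (hz : (z : ℕ) = y)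
    (hC : ∀ a b, b ∈ laterNbrs G σ a → Before σ p y a b → Covered C a b)
    (hxz : z ∈ laterNbrs G σ x → Covered C x z) :
    ∀ a b, b ∈ laterNbrs G σ a → Before σ p (y + 1) a b → Covered C a b := by
  intro a c hac hb
  by_cases h : a = x ∧ c = z
  · rw [h.1, h.2] at hac ⊢; exact hxz hac
  · refine hC a c hac ?_
    rcases hb with hb | ⟨h1, h2⟩
    · exact .inl hb
    · refine .inr ⟨h1, lt_of_le_of_ne (Nat.lt_succ_iff.1 h2) fun h3 => h ⟨?_, ?_⟩⟩
      · exact σ.injective (Fin.ext (h1.trans hp.symm))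
      · exact Fin.ext (h3.trans hz.symm)

/-- While the check has not failed, the rows used form a prefix of a path. -/
def Sound (G : SimpleGraph (Fin n)) (σ : Fin n ≃ Fin n) (b : ℕ → ℕ) (t p y : ℕ)
    (q : ℕ × ℕ × ℕ) : Prop :=
  q.1 ≠ 0 → (∀ a c, c ∈ laterNbrs G σ a → Before σ p y a c → Covered (rowFamily n b q.2.1) a c) ∧
    ∀ Zs C', Path G σ (depList G σ) q.2.2 (rowFamily n b q.2.1) Zs C' →
      ∃ Zs', Path G σ (depList G σ) t ∅ Zs' C'

/-- Paths grow at the front, so `Sound` expresses a prefix by its effect on continuations: any path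
from the present state extends to one from the start. Accepting a row prepends one step to the
continuation; a rejected row clears the flag and makes the claim vacuous. -/
theorem Sound.step {t p : ℕ} {x z : Fin n} (hp : (σ x : ℕ) = p) {q : ℕ × ℕ × ℕ}
    (h : Sound G σ b t p z q) : Sound G σ b t p (z + 1) (edgeStep G σ L b x z q) := by
  rw [edgeStep]
  split_ifs with h1 h2
  · intro hq
    obtain ⟨h3, h4⟩ := h hq
    have hf := firstUncovered_depList_eq_some h1.1 h1.2 (by rw [hp]; exact h3)
    dsimp only
    rw [rowFamily_succ]
    refine ⟨covered_before_succ hp rfl (fun a c hac hb => (h3 a c hac hb).mono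
      (Finset.subset_insert _ _)) fun _ => ⟨_, Finset.mem_insert_self _ _, h2.2.1.2.1,
        h2.2.1.2.2.1⟩, fun Zs C' hZ => h4 _ C' (.step hf h2.2.1 h2.2.2 hZ)⟩
  · intro hq; exact absurd rfl hq
  · intro hq
    obtain ⟨h3, h4⟩ := h hq
    refine ⟨covered_before_succ hp rfl h3 fun hz => ?_, h4⟩
    by_contra hc
    exact h1 ⟨hz, hc⟩

/-- If the rows describe a path, then the check does not fail. -/
def Follows (G : SimpleGraph (Fin n)) (σ : Fin n ≃ Fin n) (b : ℕ → ℕ)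
    (Ys : List (Finset (Fin n))) (D : Finset (Finset (Fin n))) (p y : ℕ)
    (q : ℕ × ℕ × ℕ) : Prop :=
  q.1 ≠ 0 ∧ (∀ a c, c ∈ laterNbrs G σ a → Before σ p y a c → Covered (rowFamily n b q.2.1) a c) ∧
    Path G σ (depList G σ) q.2.2 (rowFamily n b q.2.1) (Ys.drop q.2.1) D

/-- The scan and the path agree on the first uncovered edge. Hence the rest of the path cannot be
empty at such an edge, and its next clique, which is the next row, passes the test. -/
theorem Follows.step {Ys : List (Finset (Fin n))} {D : Finset (Finset (Fin n))} {p : ℕ}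
    {x z : Fin n} (hp : (σ x : ℕ) = p) (hL : Ys.length ≤ L)
    (hYs : ∀ k (hk : k < Ys.length), rowSet n b k = Ys[k]) {q : ℕ × ℕ × ℕ}
    (h : Follows G σ b Ys D p z q) :
    Follows G σ b Ys D p (z + 1) (edgeStep G σ L b x z q) := by
  obtain ⟨h2, h3, h4⟩ := h
  rw [edgeStep]
  by_cases h1 : z ∈ laterNbrs G σ x ∧ ¬ Covered (rowFamily n b q.2.1) x z
  · have hf := firstUncovered_depList_eq_some h1.1 h1.2 (by rw [hp]; exact h3)
    rcases hd : Ys.drop q.2.1 with _ | ⟨Z, Zs⟩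
    · rw [hd] at h4
      cases h4 with
      | done hn => rw [hn] at hf; cases hf
    · have hk : q.2.1 < Ys.length := by
        by_contra hk
        rw [List.drop_eq_nil_of_le (not_lt.1 hk)] at hd
        cases hd
      rw [List.drop_eq_getElem_cons hk, ← hYs _ hk] at hd h4
      cases h4 with
      | step hf' hZ ht hP =>
        rw [hf] at hf'
        cases hf'
        rw [if_pos h1, if_pos ⟨hk.trans_le hL, hZ, ht⟩]
        refine ⟨h2, ?_, ?_⟩
        · dsimp only
          rw [rowFamily_succ]
          exact covered_before_succ hp rfl (fun a c hac hb => (h3 a c hac hb).mono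
            (Finset.subset_insert _ _)) fun _ => ⟨_, Finset.mem_insert_self _ _, hZ.2.1,
              hZ.2.2.1⟩
        · dsimp only
          rw [rowFamily_succ]
          exact hP
  · rw [if_neg h1]
    refine ⟨h2, covered_before_succ hp rfl h3 fun hz => ?_, h4⟩
    by_contra hc
    exact h1 ⟨hz, hc⟩

end Step

/-- The entry in row `e₁` and column `e₂` of array `a`. -/
abbrev entry (a : ℕ) (e₁ e₂ : Expr) : Expr := .read a (.add (.read 8 e₁) e₂)

/-- The store contains the results of the preprocessing that are needed for a check. -/
structure Ready {n : ℕ} (G : SimpleGraph (Fin n)) (σ : Fin n ≃ Fin n) (t L : ℕ) (s : Store) :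
    Prop where
  size : s 0 0 = n
  budget : s 1 0 = t
  adj : ∀ u v : Fin n, s 2 (u * n + v) ≠ 0 ↔ G.Adj u v
  mul : ∀ l ≤ n * n, s 8 l = l * n
  rows : s 11 0 = L
  rows_le : L ≤ n * n
  ord : ∀ p : Fin n, s 14 p = σ.symm p
  pos : ∀ v : Fin n, s 15 v = σ v

section Check

variable {n : ℕ} {G : SimpleGraph (Fin n)} {σ : Fin n ≃ Fin n} {t L : ℕ} {s : Store}

theorem Ready.congr (h : Ready G σ t L s) {s' : Store}
    (hs : ∀ a ∈ [0, 1, 2, 8, 11, 14, 15], s' a = s a) : Ready G σ t L s' := by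
  obtain ⟨h1, h2, h3, h4, h5, h6, h7, h8⟩ := h
  constructor <;> simp_all

theorem Ready.mul_fin (h : Ready G σ t L s) (v : Fin n) : s 8 v = v * n :=
  h.mul v (v.2.le.trans (Nat.le_mul_self n))

/-- Set the flag `22` if the pair of the vertices `28` and `21` is covered by the rows in use. -/
def coveredCmd : Cmd :=
  .seq (assign 22 (.const 0)) (forTo 11 23 (cond (.sub (var 4) (var 23))
    (cond (entry 5 (var 23) (var 28)) (cond (entry 5 (var 23) (var 21))
      (assign 22 (.const 1))))))

/-- The loop goes over all `L` rows and skips the unused ones: the number of rows in use is changed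
by the check, and a variable that is written to may not bound a loop. -/
theorem coveredCmd_spec (h : Ready G σ t L s) {x y : Fin n} (hx : s 28 0 = x) (hy : s 21 0 = y)
    (hk : s 4 0 ≤ L) :
    coveredCmd.sem s 22 0 ≠ 0 ↔ Covered (rowFamily n (s 5) (s 4 0)) x y := by
  rw [coveredCmd, sem_seq]
  set s₁ := (assign 22 (.const 0)).sem s with hs₁
  have e : ∀ a, a ≠ 22 → s₁ a = s a := fun a ha => sem_frame (by simpa [mods] using ha) s
  have key := sem_forTo_induction (b := 11) (v := 23) (s := s₁)
    (p := cond (.sub (var 4) (var 23)) (cond (entry 5 (var 23) (var 28))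
      (cond (entry 5 (var 23) (var 21)) (assign 22 (.const 1)))))
    (fun k s' => s' 22 0 ≠ 0 ↔
      ∃ l < k, l < s 4 0 ∧ s 5 (l * n + x) ≠ 0 ∧ s 5 (l * n + y) ≠ 0)
    (by simp [hs₁, sem, Store.set_apply, Expr.eval]) (by
      intro k hkL s' hv hf hI
      rw [e 11 (by decide), h.rows] at hkL
      have hex : (∃ l < k + 1, l < s 4 0 ∧ s 5 (l * n + x) ≠ 0 ∧ s 5 (l * n + y) ≠ 0) ↔
          (∃ l < k, l < s 4 0 ∧ s 5 (l * n + x) ≠ 0 ∧ s 5 (l * n + y) ≠ 0) ∨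
            (k < s 4 0 ∧ s 5 (k * n + x) ≠ 0 ∧ s 5 (k * n + y) ≠ 0) := by
        simp only [Nat.lt_succ_iff_lt_or_eq, or_and_right, exists_or, exists_eq_left]
      rw [hex, ← hI, Store.set_of_ne (by decide)]
      simp only [sem_ite, sem_skip, sem_write, Expr.eval, hv, hf 4 (by decide),
        hf 5 (by decide), hf 8 (by decide), hf 28 (by decide), hf 21 (by decide),
        e 4 (by decide), e 5 (by decide), e 8 (by decide), e 28 (by decide), e 21 (by decide),
        hx, hy, h.mul k (hkL.le.trans h.rows_le)]
      simp only [branch]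
      split_ifs with h1 h2 h3
      · have : ¬ k < s 4 0 := by omega
        simp [this]
      · simp [h2]
      · simp [h3]
      · have : k < s 4 0 := by omega
        simp [Store.set_apply, this, h2, h3])
  rw [e 11 (by decide), h.rows] at key
  rw [key, covered_rowFamily]
  exact exists_congr fun l => ⟨fun h => h.2, fun h' => ⟨h'.1.trans_le hk, h'⟩⟩

/-- The tests only ever raise a flag, so it is down at the end iff it was down before and the test
raised no objection. -/
theorem flag_branch {c a : ℕ} {s : Store} :
    branch c (s.set a 0 1) s a 0 = 0 ↔ c = 0 ∧ s a 0 = 0 := by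
  by_cases hc : c = 0
  · simp [hc, branch_zero]
  · simp [hc, branch_of_ne hc, Store.set_apply]

theorem flag_branch' {c a : ℕ} {s : Store} :
    branch c s (s.set a 0 1) a 0 = 0 ↔ c ≠ 0 ∧ s a 0 = 0 := by
  by_cases hc : c = 0
  · simp [hc, branch_zero, Store.set_apply]
  · simp [hc, branch_of_ne hc]

/-- Set the flag `24` unless all members of the current row are equal or adjacent to
vertex `26`. -/
def starCmd : Cmd :=
  forTo 0 27 (cond (entry 5 (var 4) (var 27))
    (cond (.add (.sub (var 26) (var 27)) (.sub (var 27) (var 26)))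
      (condZero (entry 2 (var 26) (var 27)) (assign 24 (.const 1)))))

/-- Inequality of two vertices is tested by the sum of both truncated differences, which vanishes
only for equal numbers. -/
theorem starCmd_spec (h : Ready G σ t L s) {u : Fin n} (hu : s 26 0 = u) (hk : s 4 0 ≤ L) :
    starCmd.sem s 24 0 = 0 ↔ s 24 0 = 0 ∧
      ∀ v ∈ rowSet n (s 5) (s 4 0), u ≠ v → G.Adj u v := by
  have key := sem_forTo_induction (b := 0) (v := 27) (s := s)
    (p := (cond (entry 5 (var 4) (var 27))
    (cond (.add (.sub (var 26) (var 27)) (.sub (var 27) (var 26)))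
      (condZero (entry 2 (var 26) (var 27)) (assign 24 (.const 1))))))
    (fun k s' => s' 24 0 = 0 ↔ s 24 0 = 0 ∧
      ∀ v : Fin n, (v : ℕ) < k → v ∈ rowSet n (s 5) (s 4 0) → u ≠ v → G.Adj u v)
    (by simp [Store.set_apply]) (by
      intro k hkn s' hv hf hI
      rw [h.size] at hkn
      have hall : (∀ v : Fin n, (v : ℕ) < k + 1 → v ∈ rowSet n (s 5) (s 4 0) → u ≠ v → G.Adj u v) ↔
          (∀ v : Fin n, (v : ℕ) < k → v ∈ rowSet n (s 5) (s 4 0) → u ≠ v → G.Adj u v) ∧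
          ((⟨k, hkn⟩ : Fin n) ∈ rowSet n (s 5) (s 4 0) → u ≠ ⟨k, hkn⟩ → G.Adj u ⟨k, hkn⟩) := by
        constructor
        · exact fun h => ⟨fun v hv => h v (by omega), h ⟨k, hkn⟩ (by simp)⟩
        · rintro ⟨h1, h2⟩ v hv
          rcases Nat.lt_succ_iff_lt_or_eq.1 hv with hv | hv
          · exact h1 v hv
          · obtain rfl : v = ⟨k, hkn⟩ := Fin.ext hv
            exact h2
      rw [hall, ← and_assoc, ← hI, Store.set_of_ne (by decide)]
      simp only [sem_ite, sem_skip, sem_write, Expr.eval, hv, hf 4 (by decide),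
        hf 5 (by decide), hf 8 (by decide), hf 26 (by decide), hf 2 (by decide), hu,
        h.mul _ (hk.trans h.rows_le), h.mul_fin u]
      rw [mem_rowSet, ← h.adj, ne_eq u, Fin.ext_iff]
      simp only [branch]
      split_ifs with h1 h2 h3
      · simp [h1]
      · have : (u : ℕ) = k := by omega
        simp [this]
      · have : (u : ℕ) ≠ k := by omega
        simp [h1, h3, Store.set_apply, this]
      · simp [h3])
  rw [h.size] at key
  rw [starCmd, key]
  exact and_congr_right fun _ => ⟨fun h v => h v v.2, fun h v _ => h v⟩

/-- Set the flag `24` unless the current row is a clique of vertices from position `20` on;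
count the members of the row in `25`. -/
def cliqueCmd : Cmd :=
  .seq (assign 24 (.const 0)) (.seq (assign 25 (.const 0))
    (forTo 0 26 (cond (entry 5 (var 4) (var 26))
      (.seq (assign 25 (.add (var 25) (.const 1)))
        (.seq (cond (.sub (var 20) (.read 15 (var 26))) (assign 24 (.const 1))) starCmd)))))

theorem cliqueCmd_spec (h : Ready G σ t L s) (hk : s 4 0 ≤ L) :
    (cliqueCmd.sem s 24 0 = 0 ↔ ∀ u ∈ rowSet n (s 5) (s 4 0), s 20 0 ≤ σ u ∧
      ∀ v ∈ rowSet n (s 5) (s 4 0), u ≠ v → G.Adj u v) ∧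
    cliqueCmd.sem s 25 0 = (rowSet n (s 5) (s 4 0)).card := by
  rw [cliqueCmd, sem_seq, sem_seq]
  set s₁ := (assign 25 (.const 0)).sem ((assign 24 (.const 0)).sem s) with hs₁
  have e : ∀ a, a ≠ 24 → a ≠ 25 → s₁ a = s a := fun a h1 h2 => by
    rw [hs₁, sem_frame (by simpa [mods] using h2), sem_frame (by simpa [mods] using h1)]
  set R := rowSet n (s 5) (s 4 0) with hR
  have key := sem_forTo_induction (b := 0) (v := 26) (s := s₁)
    (p := cond (entry 5 (var 4) (var 26))
      (.seq (assign 25 (.add (var 25) (.const 1)))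
        (.seq (cond (.sub (var 20) (.read 15 (var 26))) (assign 24 (.const 1))) starCmd)))
    (fun k s' => (s' 24 0 = 0 ↔ ∀ u : Fin n, (u : ℕ) < k → u ∈ R → s 20 0 ≤ σ u ∧
        ∀ v ∈ R, u ≠ v → G.Adj u v) ∧ s' 25 0 = (R.filter fun u : Fin n => (u : ℕ) < k).card)
    (by simp [Store.set_apply, hs₁, sem_write, Expr.eval]) (by
      intro k hkn s' hv hf ⟨hI1, hI2⟩
      rw [e 0 (by decide) (by decide), h.size] at hkn
      have f : ∀ a, a ∉ [24, 25, 26, 27] → s' a = s a := fun a ha => by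
        simp only [List.mem_cons, List.not_mem_nil, or_false, not_or] at ha
        rw [hf a (by simp [mods, starCmd, ha]), e a ha.1 ha.2.1]
      set u : Fin n := ⟨k, hkn⟩ with hu
      rw [Store.set_of_ne (by decide), Store.set_of_ne (by decide)]
      have hc : (entry 5 (var 4) (var 26)).eval s' ≠ 0 ↔ u ∈ R := by
        simp only [Expr.eval, f 5 (by decide), f 8 (by decide), f 4 (by decide), hv,
          h.mul _ (hk.trans h.rows_le)]
        rw [hR, mem_rowSet]
      have hall : (∀ v : Fin n, (v : ℕ) < k + 1 → v ∈ R → s 20 0 ≤ σ v ∧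
          ∀ w ∈ R, v ≠ w → G.Adj v w) ↔
          (∀ v : Fin n, (v : ℕ) < k → v ∈ R → s 20 0 ≤ σ v ∧ ∀ w ∈ R, v ≠ w → G.Adj v w) ∧
          (u ∈ R → s 20 0 ≤ σ u ∧ ∀ w ∈ R, u ≠ w → G.Adj u w) := by
        constructor
        · exact fun h => ⟨fun v hv => h v (by omega), h u (by simp [hu])⟩
        · rintro ⟨h1, h2⟩ v hv
          rcases Nat.lt_succ_iff_lt_or_eq.1 hv with hv | hv
          · exact h1 v hv
          · obtain rfl : v = u := Fin.ext hv
            exact h2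
      have hfil : R.filter (fun v : Fin n => (v : ℕ) < k + 1) =
          if u ∈ R then insert u (R.filter fun v : Fin n => (v : ℕ) < k)
          else R.filter fun v : Fin n => (v : ℕ) < k := by
        have : ∀ v : Fin n, (v : ℕ) < k + 1 ↔ v = u ∨ (v : ℕ) < k := fun v => by
          rw [Fin.ext_iff]; simp only [hu]; omega
        split_ifs with huR
        · ext v
          simp only [Finset.mem_filter, Finset.mem_insert, this]
          constructor
          · tauto
          · rintro (rfl | h) <;> tauto
        · ext v
          simp only [Finset.mem_filter, this]
          constructor
          · rintro ⟨h1, rfl | h2⟩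
            · exact absurd h1 huR
            · exact ⟨h1, h2⟩
          · tauto
      rw [hall, hfil, ← hI1, sem_ite]
      by_cases huR : u ∈ R
      · rw [branch_of_ne (hc.2 huR), sem_seq, sem_seq]
        set s₂ := (assign 25 (.add (var 25) (.const 1))).sem s' with hs₂
        set s₃ := (cond (.sub (var 20) (.read 15 (var 26))) (assign 24 (.const 1))).sem s₂
          with hs₃
        have g₂ : ∀ a, a ≠ 25 → s₂ a = s' a := fun a ha =>
          sem_frame (by simpa [mods] using ha) s'
        have g₃ : ∀ a, a ≠ 24 → s₃ a = s₂ a := fun a ha =>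
          sem_frame (by simpa [mods] using ha) s₂
        have g : ∀ a, a ∉ [24, 25, 26, 27] → s₃ a = s a := fun a ha => by
          rw [← f a ha]
          simp only [List.mem_cons, List.not_mem_nil, or_false, not_or] at ha
          rw [g₃ a ha.1, g₂ a ha.2.1]
        have hst := starCmd_spec (s := s₃) (u := u)
          (h.congr fun a ha => g a (by revert a; decide))
          (by rw [g₃ 26 (by decide), g₂ 26 (by decide), hv])
          (by rw [g 4 (by decide)]; exact hk)
        rw [g 5 (by decide), g 4 (by decide), ← hR] at hst
        constructor
        · rw [hst, hs₃]
          simp only [sem_ite, sem_skip, sem_write, Expr.eval, flag_branch, g₂ 20 (by decide),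
            g₂ 15 (by decide), g₂ 26 (by decide), g₂ 24 (by decide), hv, f 20 (by decide),
            f 15 (by decide)]
          rw [show s 15 k = σ u from h.pos u, Nat.sub_eq_zero_iff_le]
          simp only [huR, true_imp_iff]
          tauto
        · rw [sem_frame (by decide), g₃ 25 (by decide), hs₂, if_pos huR,
            Finset.card_insert_of_notMem (by simp [hu])]
          simp [sem_write, Store.set_apply, Expr.eval, hI2]
      · rw [branch_of_eq (not_not.1 (mt hc.1 huR)), if_neg huR]
        exact ⟨⟨fun h => ⟨h, fun h' => absurd h' huR⟩, fun h => h.1⟩, hI2⟩)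
  rw [e 0 (by decide) (by decide), h.size] at key
  refine ⟨key.1.trans ⟨fun h u => h u u.2, fun h u _ => h u⟩, ?_⟩
  rw [key.2, Finset.filter_true_of_mem fun u _ => u.2]

/-- Set the flag `24` unless the current row can be used for the edge between the vertices `28`
and `21`. -/
def validCmd : Cmd :=
  .seq cliqueCmd
    (.seq (condZero (entry 5 (var 4) (var 28)) (assign 24 (.const 1)))
      (.seq (condZero (entry 5 (var 4) (var 21)) (assign 24 (.const 1)))
        (.seq (cond (.sub (var 25) (var 16)) (assign 24 (.const 1)))
          (condZero (.sub (var 11) (var 4)) (assign 24 (.const 1))))))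

/-- For a clique through `x` and `y`, adjacency to both is automatic, so lying in `N_d[x] ∩ N[y]`
only says that no member comes before `x`. This is the form that the machine tests. -/
theorem isCandidate_iff {x y : Fin n} {Z : Finset (Fin n)} (hxy : y ∈ laterNbrs G σ x) :
    IsCandidate G σ x y Z ↔
      (∀ u ∈ Z, σ x ≤ σ u ∧ ∀ v ∈ Z, u ≠ v → G.Adj u v) ∧ x ∈ Z ∧ y ∈ Z := by
  constructor
  · rintro ⟨h1, h2, h3, h4⟩
    refine ⟨fun u hu => ⟨?_, fun v hv huv => h1 hu hv huv⟩, h2, h3⟩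
    rcases (h4 hu).1 with rfl | h
    · exact le_rfl
    · exact h.2.le
  · rintro ⟨h1, h2, h3⟩
    refine ⟨fun u hu v hv huv => (h1 u hu).2 v hv huv, h2, h3, fun u hu => ⟨?_, ?_⟩⟩
    · by_cases hux : u = x
      · exact .inl hux
      · refine .inr ⟨(h1 x h2).2 u hu (Ne.symm hux), lt_of_le_of_ne (h1 u hu).1 ?_⟩
        exact fun h => hux (σ.injective h.symm)
    · by_cases huy : u = y
      · exact .inl huy
      · exact .inr ((h1 y h3).2 u hu (Ne.symm huy))

theorem validCmd_spec (h : Ready G σ t L s) {x y : Fin n} (hx : s 28 0 = x) (hy : s 21 0 = y)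
    (hp : s 20 0 = σ x) (hxy : y ∈ laterNbrs G σ x) (hk : s 4 0 ≤ L) :
    (validCmd.sem s 24 0 = 0 ↔ RowValid G σ L (s 5) x y (s 4 0) (s 16 0)) ∧
      validCmd.sem s 25 0 = (rowSet n (s 5) (s 4 0)).card := by
  obtain ⟨h1, h2⟩ := cliqueCmd_spec h hk
  rw [validCmd, sem_seq]
  set s₁ := cliqueCmd.sem s with hs₁
  have e : ∀ a, a ∉ cliqueCmd.mods → s₁ a = s a := fun a ha => sem_frame ha s
  constructor
  · simp only [sem_seq]
    set s₂ := (condZero (entry 5 (var 4) (var 28)) (assign 24 (.const 1))).sem s₁ with hs₂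
    have e₂ : ∀ a, a ≠ 24 → s₂ a = s₁ a := fun a ha => sem_frame (by simpa [mods] using ha) _
    set s₃ := (condZero (entry 5 (var 4) (var 21)) (assign 24 (.const 1))).sem s₂ with hs₃
    have e₃ : ∀ a, a ≠ 24 → s₃ a = s₂ a := fun a ha => sem_frame (by simpa [mods] using ha) _
    set s₄ := (cond (.sub (var 25) (var 16)) (assign 24 (.const 1))).sem s₃ with hs₄
    have e₄ : ∀ a, a ≠ 24 → s₄ a = s₃ a := fun a ha => sem_frame (by simpa [mods] using ha) _
    rw [sem_ite, sem_skip, sem_write]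
    simp only [Expr.eval]
    have c₄ : s₄ 24 0 = 0 ↔ s₃ 25 0 - s₃ 16 0 = 0 ∧ s₃ 24 0 = 0 := by
      simp only [hs₄, sem_ite, sem_skip, sem_write, Expr.eval, flag_branch]
    have c₃ : s₃ 24 0 = 0 ↔ s₂ 5 (s₂ 8 (s₂ 4 0) + s₂ 21 0) ≠ 0 ∧ s₂ 24 0 = 0 := by
      simp only [hs₃, sem_ite, sem_skip, sem_write, Expr.eval, flag_branch']
    have c₂ : s₂ 24 0 = 0 ↔ s₁ 5 (s₁ 8 (s₁ 4 0) + s₁ 28 0) ≠ 0 ∧ s₁ 24 0 = 0 := by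
      simp only [hs₂, sem_ite, sem_skip, sem_write, Expr.eval, flag_branch']
    rw [flag_branch', c₄, c₃, c₂, h1, e₄ 11 (by decide), e₄ 4 (by decide), e₃ 11 (by decide), e₃ 4 (by decide),
      e₃ 25 (by decide), e₃ 16 (by decide), e₂ 11 (by decide), e₂ 4 (by decide),
      e₂ 25 (by decide), e₂ 16 (by decide), e₂ 5 (by decide), e₂ 8 (by decide),
      e₂ 21 (by decide), h2, e 11 (by decide), e 4 (by decide), e 16 (by decide),
      e 5 (by decide), e 8 (by decide), e 21 (by decide), e 28 (by decide),
      h.mul _ (hk.trans h.rows_le), hx, hy, h.rows, RowValid, isCandidate_iff hxy, mem_rowSet,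
      mem_rowSet, hp, Nat.sub_eq_zero_iff_le, Nat.sub_ne_zero_iff_lt]
    simp only [Fin.val_fin_le]
    exact ⟨fun ⟨a, b, c, d, e⟩ => ⟨a, ⟨e, d, c⟩, b⟩, fun ⟨a, ⟨e, d, c⟩, b⟩ => ⟨a, b, c, d, e⟩⟩
  · rw [sem_frame (by decide), h2]

/-- Process the edge between the vertices `28` and `21`, if there is one. -/
def edgeCmd : Cmd :=
  cond (entry 2 (var 28) (var 21)) (cond (.sub (.read 15 (var 21)) (var 20))
    (.seq coveredCmd (condZero (var 22) (.seq validCmd (ite (var 24) (assign 3 (.const 0))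
      (.seq (assign 4 (.add (var 4) (.const 1))) (assign 16 (.sub (var 16) (var 25)))))))))

/-- The success flag, the number of rows in use, and the budget. -/
def checkState (s : Store) : ℕ × ℕ × ℕ := (s 3 0, s 4 0, s 16 0)

theorem edgeCmd_spec (h : Ready G σ t L s) {x y : Fin n} (hx : s 28 0 = x) (hy : s 21 0 = y)
    (hp : s 20 0 = σ x) (hk : s 4 0 ≤ L) :
    checkState (edgeCmd.sem s) = edgeStep G σ L (s 5) x y (checkState s) := by
  classical
  have hlater : y ∈ laterNbrs G σ x ↔ s 2 (x * n + y) ≠ 0 ∧ s 15 y - s 20 0 ≠ 0 := by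
    rw [h.adj, h.pos, hp, Nat.sub_ne_zero_iff_lt]
    rfl
  have hcov := coveredCmd_spec h hx hy hk
  rw [edgeCmd]
  simp only [sem_ite, sem_skip, Expr.eval, hx, hy, h.mul_fin]
  by_cases h1 : s 2 (x * n + y) ≠ 0
  swap
  · rw [branch_of_eq (not_not.1 h1), edgeStep, if_neg (fun h' => h1 (hlater.1 h'.1).1)]
  by_cases h2 : s 15 y - s 20 0 ≠ 0
  swap
  · rw [branch_of_ne h1, branch_of_eq (not_not.1 h2), edgeStep,
      if_neg (fun h' => h2 (hlater.1 h'.1).2)]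
  have hxy := hlater.2 ⟨h1, h2⟩
  rw [branch_of_ne h1, branch_of_ne h2, sem_seq, sem_ite, sem_skip, sem_seq]
  set s₁ := coveredCmd.sem s with hs₁
  have e : ∀ a, a ∉ coveredCmd.mods → s₁ a = s a := fun a ha => sem_frame ha s
  simp only [Expr.eval]
  by_cases h3 : s₁ 22 0 ≠ 0
  · rw [branch_of_ne h3, edgeStep, if_neg (fun h' => h'.2 (hcov.1 h3))]
    simp only [checkState, e 3 (by decide), e 4 (by decide), e 16 (by decide)]
  rw [branch_of_eq (not_not.1 h3), edgeStep, if_pos ⟨hxy, fun h' => h3 (hcov.2 h')⟩]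
  obtain ⟨h4, h5⟩ := validCmd_spec (s := s₁) (x := x) (y := y)
    (h.congr fun a ha => e a (by revert a; decide)) (by rw [e 28 (by decide), hx])
    (by rw [e 21 (by decide), hy]) (by rw [e 20 (by decide), hp]) hxy
    (by rw [e 4 (by decide)]; exact hk)
  rw [e 5 (by decide), e 4 (by decide), e 16 (by decide)] at h4
  rw [e 5 (by decide), e 4 (by decide)] at h5
  set s₂ := validCmd.sem s₁ with hs₂
  have e₂ : ∀ a, a ∉ coveredCmd.mods → a ∉ validCmd.mods → s₂ a = s a := fun a ha ha' =>
    (sem_frame ha' s₁).trans (e a ha)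
  change _ ↔ RowValid G σ L (s 5) x y (checkState s).2.1 (checkState s).2.2 at h4
  rw [sem_ite]
  simp only [Expr.eval]
  by_cases h6 : s₂ 24 0 = 0
  · rw [branch_of_eq h6, if_pos (h4.1 h6)]
    simp [checkState, sem_seq, sem_write, Store.set_apply, Expr.eval, h5,
      e₂ 3 (by decide) (by decide), e₂ 4 (by decide) (by decide), e₂ 16 (by decide) (by decide)]
  · rw [branch_of_ne h6, if_neg (fun h' => h6 (h4.2 h'))]
    simp [checkState, sem_write, Store.set_apply, Expr.eval,
      e₂ 4 (by decide) (by decide), e₂ 16 (by decide) (by decide)]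

/-- Check whether the rows of array `5` describe a path of the search. -/
def checkCmd : Cmd :=
  .seq (.seq (assign 3 (.const 1)) (.seq (assign 4 (.const 0)) (assign 16 (var 1))))
    (forTo 0 20 (.seq (assign 28 (.read 14 (var 20))) (forTo 0 21 edgeCmd)))

/-- Stated for an arbitrary invariant, since the same double loop serves both directions: `Sound`
for rows that are accepted, `Follows` for rows that encode a path. -/
theorem checkCmd_induction (h : Ready G σ t L s) (I : ℕ → ℕ → ℕ × ℕ × ℕ → Prop)
    (h0 : I 0 0 (1, 0, t))
    (hstep : ∀ x y : Fin n, ∀ q, I (σ x) y q → I (σ x) (y + 1) (edgeStep G σ L (s 5) x y q))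
    (hnext : ∀ p < n, ∀ q, I p n q → I (p + 1) 0 q) :
    I n 0 (checkState (checkCmd.sem s)) := by
  rw [checkCmd, sem_seq]
  set s₁ := (Cmd.seq (assign 3 (.const 1)) (.seq (assign 4 (.const 0))
    (assign 16 (var 1)))).sem s with hs₁
  have e : ∀ a, a ∉ [3, 4, 16] → s₁ a = s a := fun a ha =>
    sem_frame (by simpa [mods] using ha) s
  have hR : ∀ s' : Store, (∀ a, a ∉ 20 :: (Cmd.seq (assign 28 (.read 14 (var 20)))
      (forTo 0 21 edgeCmd)).mods → s' a = s₁ a) → Ready G σ t L s' := fun s' hs' =>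
    h.congr fun a ha => (hs' a (by revert a; decide)).trans (e a (by revert a; decide))
  have key := sem_forTo_induction (b := 0) (v := 20) (s := s₁)
    (p := .seq (assign 28 (.read 14 (var 20))) (forTo 0 21 edgeCmd))
    (fun k s' => s' 4 0 ≤ L ∧ I k 0 (checkState s')) (by
      simp [hs₁, checkState, sem_seq, sem_write, Store.set_apply, Expr.eval, h.budget, h0]) (by
      intro p hp s' hv hf ⟨hI1, hI2⟩
      rw [e 0 (by decide), h.size] at hp
      have hR' := hR s' hf
      set s₂ := (assign 28 (.read 14 (var 20))).sem s' with hs₂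
      have e₂ : ∀ a, a ≠ 28 → s₂ a = s' a := fun a ha => sem_frame (by simpa [mods] using ha) _
      set x := σ.symm ⟨p, hp⟩ with hx
      have hσx : (σ x : ℕ) = p := by simp [hx]
      have h28 : s₂ 28 0 = x := by
        simp only [hs₂, sem_write, Store.set_apply, Expr.eval, and_self, if_true, hv]
        exact hR'.ord ⟨p, hp⟩
      have inner := sem_forTo_induction (b := 0) (v := 21) (s := s₂) (p := edgeCmd)
        (fun k s'' => s'' 4 0 ≤ L ∧ I p k (checkState s'')) (by
          simpa [checkState, Store.set_apply, e₂] using ⟨hI1, hI2⟩) (by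
          intro k hk s₃ hv' hf' ⟨hJ1, hJ2⟩
          rw [e₂ 0 (by decide), hR'.size] at hk
          have e₃ : ∀ a, a ∉ 28 :: 21 :: edgeCmd.mods → s₃ a = s' a := fun a ha =>
            (hf' a (fun h' => ha (List.mem_cons_of_mem _ h'))).trans
              (e₂ a (fun h' => ha (by simp [h'])))
          have h5 : s₃ 5 = s 5 := by
            rw [e₃ 5 (by decide), hf 5 (by decide), e 5 (by decide)]
          have hstep' := edgeCmd_spec (s := s₃) (x := x) (y := ⟨k, hk⟩)
            (hR'.congr fun a ha => e₃ a (by revert a; decide))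
            ((congrFun (hf' 28 (by decide)) 0).trans h28) hv'
            (by rw [hσx, e₃ 20 (by decide), hv]) hJ1
          rw [h5] at hstep'
          have hst : ∀ s₄ : Store, checkState (s₄.set 21 0 (k + 1)) = checkState s₄ := fun _ => rfl
          rw [hst, hstep', Store.set_of_ne (by decide)]
          have hle : (checkState (edgeCmd.sem s₃)).2.1 ≤ L := by
            rw [hstep']; exact edgeStep_le hJ1
          refine ⟨hle, ?_⟩
          have := hstep x ⟨k, hk⟩ (checkState s₃)
          rw [hσx] at this
          exact this hJ2)
      rw [e₂ 0 (by decide), hR'.size] at inner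
      exact ⟨inner.1, hnext p hp _ inner.2⟩)
  rw [e 0 (by decide), h.size] at key
  exact key.2

theorem before_succ_zero_iff {p : ℕ} {a c : Fin n} :
    Before σ (p + 1) 0 a c ↔ Before σ p n a c := by
  have := c.2
  simp only [Before]
  omega

theorem checkCmd_sound (h : Ready G σ t L s) (hok : checkCmd.sem s 3 0 ≠ 0) :
    ∃ Zs, Path G σ (depList G σ) t ∅ Zs (rowFamily n (s 5) (checkCmd.sem s 4 0)) := by
  have key := checkCmd_induction h (Sound G σ (s 5) t)
    (fun _ => ⟨fun a c _ hb => by simp [Before] at hb, fun Zs C' hZ => ⟨Zs, hZ⟩⟩)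
    (fun x y q hq => hq.step rfl)
    (fun p _ q hq h1 => ⟨fun a c hac hb => (hq h1).1 a c hac (before_succ_zero_iff.1 hb),
      (hq h1).2⟩)
  obtain ⟨h1, h2⟩ := key hok
  -- After the scan all edges are covered, so the empty continuation is a path.
  refine h2 [] _ (.done ?_)
  rw [firstUncovered, List.find?_eq_none]
  rintro ⟨a, c⟩ hac
  simpa using h1 a c (((isDEP_depList G σ).mem_iff a c).1 hac) (.inl (σ a).2)

theorem checkCmd_complete (h : Ready G σ t L s) {Zs : List (Finset (Fin n))}
    {D : Finset (Finset (Fin n))} (hP : Path G σ (depList G σ) t ∅ Zs D) (hL : Zs.length ≤ L)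
    (hZs : ∀ k (hk : k < Zs.length), rowSet n (s 5) k = Zs[k]) :
    checkCmd.sem s 3 0 ≠ 0 :=
  (checkCmd_induction h (Follows G σ (s 5) Zs D)
    ⟨one_ne_zero, fun a c _ hb => by simp [Before] at hb, hP⟩
    (fun x y q hq => hq.step rfl hL hZs)
    (fun p _ q hq => ⟨hq.1, fun a c hac hb => hq.2.1 a c hac (before_succ_zero_iff.1 hb),
      hq.2.2⟩)).1

end Check

/-! ### Counting through all contents of the cells in use -/

section Counter

/-- The number of cells in use before cell `j`, where `act` is the indicator of these cells. -/
def rank (act : ℕ → ℕ) (j : ℕ) : ℕ := ∑ i ∈ Finset.range j, act i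

/-- The number whose binary digits are the first `j` cells of `b`, without the cells that are not
in use. -/
def value (act b : ℕ → ℕ) (j : ℕ) : ℕ := ∑ i ∈ Finset.range j, b i * 2 ^ rank act i

variable {act b b' : ℕ → ℕ}

theorem value_succ (j : ℕ) : value act b (j + 1) = value act b j + b j * 2 ^ rank act j :=
  Finset.sum_range_succ _ _

theorem rank_succ (j : ℕ) : rank act (j + 1) = rank act j + act j := Finset.sum_range_succ _ _

theorem value_lt (h : ∀ i, act i ≤ 1) (hb : ∀ i, b i ≤ act i) (j : ℕ) :
    value act b j < 2 ^ rank act j := by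
  induction j with
  | zero => simp [value, rank]
  | succ j ih =>
    rw [value_succ, rank_succ]
    have h1 := h j
    have h2 := hb j
    interval_cases h3 : act j
    · obtain h4 : b j = 0 := by omega
      simpa [h4] using ih
    · have : b j * 2 ^ rank act j ≤ 1 * 2 ^ rank act j := Nat.mul_le_mul_right _ h2
      rw [pow_succ]
      omega

/-- Uniqueness of binary expansions: the lower digits sum to less than the weight of the top cell,
so the top digit is determined. -/
theorem eq_of_value_eq (h : ∀ i, act i ≤ 1) (hb : ∀ i, b i ≤ act i) (hb' : ∀ i, b' i ≤ act i)
    {j : ℕ} (hv : value act b j = value act b' j) : ∀ i < j, b i = b' i := by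
  induction j with
  | zero => intro i hi; omega
  | succ j ih =>
    rw [value_succ, value_succ] at hv
    have h1 := value_lt h hb j
    have h2 := value_lt h hb' j
    have hj : b j = b' j := by
      have h3 := (hb j).trans (h j)
      have h4 := (hb' j).trans (h j)
      interval_cases b j <;> interval_cases b' j <;> omega
    rw [hj, Nat.add_right_cancel_iff] at hv
    intro i hi
    rcases Nat.lt_succ_iff_lt_or_eq.1 hi with hi | rfl
    · exact ih hv i hi
    · exact hj

theorem value_congr {j : ℕ} (h : ∀ i < j, b i = b' i) : value act b j = value act b' j :=
  Finset.sum_congr rfl fun i hi => by rw [h i (Finset.mem_range.1 hi)]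

/-- Add one to the number represented by the cells in use, with the final carry in `22`. -/
def incrementCmd : Cmd :=
  .seq (assign 22 (.const 1)) (forTo 7 20 (cond (.read 12 (var 20)) (cond (var 22)
    (ite (.read 5 (var 20)) (.write 5 (var 20) (.const 0))
      (.seq (.write 5 (var 20) (.const 1)) (assign 22 (.const 0)))))))

/-- The loop conserves value plus weighted carry: the carry starts as 1 at weight `2 ^ 0`, and each
digit in use passes it on with doubled weight or absorbs it. A final carry signals overflow. -/
theorem incrementCmd_spec {s : Store} (h : ∀ i, s 12 i ≤ 1) (hb : ∀ i, s 5 i ≤ s 12 i) :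
    (∀ i, incrementCmd.sem s 5 i ≤ s 12 i) ∧ incrementCmd.sem s 22 0 ≤ 1 ∧
      value (s 12) (incrementCmd.sem s 5) (s 7 0) +
        incrementCmd.sem s 22 0 * 2 ^ rank (s 12) (s 7 0) = value (s 12) (s 5) (s 7 0) + 1 := by
  rw [incrementCmd, sem_seq]
  set s₁ := (assign 22 (.const 1)).sem s with hs₁
  have e : ∀ a, a ≠ 22 → s₁ a = s a := fun a ha => sem_frame (by simpa [mods] using ha) s
  rw [← e 12 (by decide), ← e 5 (by decide), ← e 7 (by decide)] at *
  have key := sem_forTo_induction (b := 7) (v := 20) (s := s₁)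
    (p := cond (.read 12 (var 20)) (cond (var 22)
      (ite (.read 5 (var 20)) (.write 5 (var 20) (.const 0))
        (.seq (.write 5 (var 20) (.const 1)) (assign 22 (.const 0))))))
    (fun k s' => (∀ i, s' 5 i ≤ s₁ 12 i) ∧ (∀ i, k ≤ i → s' 5 i = s₁ 5 i) ∧ s' 22 0 ≤ 1 ∧
      value (s₁ 12) (s' 5) k + s' 22 0 * 2 ^ rank (s₁ 12) k = value (s₁ 12) (s₁ 5) k + 1) (by
      rw [Store.set_of_ne (by decide), Store.set_of_ne (by decide)]
      refine ⟨hb, fun _ _ => rfl, ?_, ?_⟩ <;>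
        simp [hs₁, sem_write, Store.set_apply, Expr.eval, value, rank]) (by
      intro k hk s' hv hf ⟨h1, h2, h3, h4⟩
      have f12 : s' 12 = s₁ 12 := hf 12 (by decide)
      have hk5 := h2 k le_rfl
      have hbk := hb k
      have hk1 := h k
      rw [Store.set_of_ne (by decide), Store.set_of_ne (by decide)]
      simp only [sem_ite, sem_skip, Expr.eval, f12, hv]
      by_cases hact : s₁ 12 k = 0
      · rw [branch_of_eq hact]
        refine ⟨h1, fun i hi => h2 i (by omega), h3, ?_⟩
        rw [value_succ, value_succ, rank_succ, hact, hk5, show s₁ 5 k = 0 by omega]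
        simpa using h4
      have hact1 : s₁ 12 k = 1 := by omega
      rw [branch_of_ne hact]
      by_cases hc : s' 22 0 = 0
      · rw [branch_of_eq hc]
        refine ⟨h1, fun i hi => h2 i (by omega), h3, ?_⟩
        rw [hc] at h4 ⊢
        rw [value_succ, value_succ, hk5]
        omega
      have hc1 : s' 22 0 = 1 := by omega
      rw [branch_of_ne hc]
      rw [hc1] at h4
      have hval : ∀ f : ℕ → ℕ, (∀ i, i ≠ k → f i = s' 5 i) →
          value (s₁ 12) f k = value (s₁ 12) (s' 5) k := fun f hf =>
        value_congr fun i hi => hf i hi.ne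
      by_cases hbit : s₁ 5 k = 0
      · rw [hk5, branch_of_eq hbit]
        have h5 : ∀ i, (Cmd.seq (.write 5 (var 20) (.const 1))
            (assign 22 (.const 0))).sem s' 5 i = if i = k then 1 else s' 5 i := by
          intro i; simp [sem_seq, sem_write, Store.set_apply, Expr.eval, hv]
        have h22 : (Cmd.seq (.write 5 (var 20) (.const 1))
            (assign 22 (.const 0))).sem s' 22 0 = 0 := by
          simp [sem_seq, sem_write, Store.set_apply, Expr.eval]
        refine ⟨fun i => ?_, fun i hi => ?_, by omega, ?_⟩
        · rw [h5]
          split_ifs with hik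
          · rw [hik, hact1]
          · exact h1 i
        · rw [h5, if_neg (by omega)]
          exact h2 i (by omega)
        · rw [value_succ, value_succ, hval _ (fun i hi => by rw [h5, if_neg hi]), h22, h5,
            if_pos rfl, hbit]
          omega
      · rw [hk5, branch_of_ne hbit]
        have h5 : ∀ i, (Cmd.write 5 (var 20) (.const 0)).sem s' 5 i =
            if i = k then 0 else s' 5 i := by
          intro i; simp [sem_write, Store.set_apply, Expr.eval, hv]
        have h22 : (Cmd.write 5 (var 20) (.const 0)).sem s' 22 0 = 1 := by
          simp [sem_write, Store.set_apply, hc1]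
        refine ⟨fun i => ?_, fun i hi => ?_, by omega, ?_⟩
        · rw [h5]
          split_ifs with hik
          · omega
          · exact h1 i
        · rw [h5, if_neg (by omega)]
          exact h2 i (by omega)
        · rw [value_succ, value_succ, hval _ (fun i hi => by rw [h5, if_neg hi]), h22, h5,
            if_pos rfl, rank_succ, hact1, pow_succ, show s₁ 5 k = 1 by omega]
          omega)
  exact ⟨key.1, key.2.2⟩

end Counter

/-! ### The main loop -/

/-- Check the current rows, and either stop or proceed to the next contents of the rows. -/
def bodyCmd : Cmd :=
  .seq checkCmd (ite (var 3) (assign 17 (.const 0))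
    (.seq incrementCmd (cond (var 22) (assign 17 (.const 0)))))

/-- The rows of `b` begin with a complete path of the search. -/
def Describes {n : ℕ} (G : SimpleGraph (Fin n)) (σ : Fin n ≃ Fin n) (t L : ℕ) (b : ℕ → ℕ) :
    Prop :=
  ∃ Zs D, Path G σ (depList G σ) t ∅ Zs D ∧ Zs.length ≤ L ∧
    ∀ k (hk : k < Zs.length), rowSet n b k = Zs[k]

theorem bodyCmd_bounds : ∀ b ∈ bodyCmd.bounds, b ∉ bodyCmd.mods ∧ b ∈ [0, 7, 11] := by decide

theorem bodyCmd_loopsOk : bodyCmd.LoopsOk := by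
  simp [bodyCmd, checkCmd, incrementCmd, edgeCmd, coveredCmd, validCmd, cliqueCmd, starCmd,
    LoopsOk, mods]

/-- Properties of the store that hold whenever the body of the main loop is entered. -/
structure LoopInv {n : ℕ} (G : SimpleGraph (Fin n)) (σ : Fin n ≃ Fin n) (t L : ℕ)
    (act : ℕ → ℕ) (s : Store) : Prop where
  ready : Ready G σ t L s
  cells : s 7 0 = n * n * n
  act_eq : s 12 = act
  bit : ∀ i, s 5 i ≤ act i
  go : s 17 0 ≠ 0
  failed : ∀ b : ℕ → ℕ, (∀ i, b i ≤ act i) →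
    value act b (n * n * n) < value act (s 5) (n * n * n) → ¬ Describes G σ t L b

theorem LoopInv.bound {n : ℕ} {G : SimpleGraph (Fin n)} {σ : Fin n ≃ Fin n} {t L : ℕ}
    {act : ℕ → ℕ} {s : Store} (h : LoopInv G σ t L act s) :
    ∀ b ∈ [0, 7, 11], s b 0 ≤ (n + 2) ^ 3 := by
  have h1 := h.ready.rows_le
  have h2 : n * n * n ≤ (n + 2) ^ 3 := by
    calc n * n * n = n ^ 3 := by ring
      _ ≤ _ := Nat.pow_le_pow_left (by omega) 3
  have h3 : n * n ≤ (n + 2) ^ 3 := by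
    calc n * n ≤ (n + 2) ^ 2 := by rw [← sq]; exact Nat.pow_le_pow_left (by omega) 2
      _ ≤ _ := Nat.pow_le_pow_right (by omega) (by omega)
  have h4 : n ≤ (n + 2) ^ 3 := (Nat.le_mul_self n).trans h3
  simp only [List.mem_cons, List.not_mem_nil, or_false, forall_eq_or_imp, forall_eq]
  exact ⟨h.ready.size ▸ h4, h.cells ▸ h2, by rw [h.ready.rows]; omega⟩

/-- What holds when the main loop terminates. -/
def LoopPost {n : ℕ} (G : SimpleGraph (Fin n)) (σ : Fin n ≃ Fin n) (t L : ℕ)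
    (act : ℕ → ℕ) (s : Store) : Prop :=
  (s 3 0 ≠ 0 ∧ ∃ Zs, Path G σ (depList G σ) t ∅ Zs (rowFamily n (s 5) (s 4 0))) ∨
    (s 3 0 = 0 ∧ ∀ b : ℕ → ℕ, (∀ i, b i ≤ act i) → ¬ Describes G σ t L b)

/-- The refuted contents are those of smaller value than the counter. A failed check refutes the
current value as well. If the increment overflows, the old value was the largest possible one, so
everything has been refuted. -/
theorem LoopInv.step {n : ℕ} {G : SimpleGraph (Fin n)} {σ : Fin n ≃ Fin n} {t L : ℕ}
    {act : ℕ → ℕ} {s : Store} (h : LoopInv G σ t L act s) (hact : ∀ i, act i ≤ 1)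
    (hact0 : ∀ i, n * n * n ≤ i → act i = 0) :
    (bodyCmd.sem s 17 0 = 0 ∧ LoopPost G σ t L act (bodyCmd.sem s)) ∨
      (LoopInv G σ t L act (bodyCmd.sem s) ∧
        value act (bodyCmd.sem s 5) (n * n * n) = value act (s 5) (n * n * n) + 1) := by
  have hfr : ∀ a, a ∉ bodyCmd.mods → bodyCmd.sem s a = s a := fun a ha => sem_frame ha s
  have hready : Ready G σ t L (bodyCmd.sem s) :=
    h.ready.congr fun a ha => hfr a (by revert a; decide)
  have h7 := hfr 7 (by decide)
  have h12 := hfr 12 (by decide)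
  rw [bodyCmd, sem_seq, sem_ite, sem_seq] at hready h7 h12 ⊢
  simp only [Expr.eval] at hready h7 h12 ⊢
  set s₁ := checkCmd.sem s with hs₁
  have e : ∀ a, a ∉ checkCmd.mods → s₁ a = s a := fun a ha => sem_frame ha s
  by_cases hok : s₁ 3 0 ≠ 0
  · rw [branch_of_ne hok]
    refine .inl ⟨by simp [sem_write, Store.set_apply, Expr.eval], .inl ?_⟩
    rw [sem_write, Store.set_of_ne (by decide), Store.set_of_ne (by decide),
      Store.set_of_ne (by decide), e 5 (by decide)]
    exact ⟨hok, checkCmd_sound h.ready hok⟩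
  have hfail : ∀ b : ℕ → ℕ, (∀ i, b i ≤ act i) →
      value act b (n * n * n) < value act (s 5) (n * n * n) + 1 → ¬ Describes G σ t L b := by
    intro b hb hlt
    rcases Nat.lt_succ_iff_lt_or_eq.1 hlt with hlt | heq
    · exact h.failed b hb hlt
    -- Equal values force equal digits below `n * n * n`, and beyond that no cell is in use, so both
    -- are zero.
    · have : b = s 5 := by
        funext i
        by_cases hi : i < n * n * n
        · exact eq_of_value_eq hact hb h.bit heq i hi
        · have h1 := hb i
          have h2 := h.bit i
          rw [hact0 i (not_lt.1 hi)] at h1 h2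
          omega
      rintro ⟨Zs, D, hP, hL, hZ⟩
      rw [this] at hZ
      exact hok (checkCmd_complete h.ready hP hL hZ)
  rw [branch_of_eq (not_not.1 hok)] at hready h7 h12 ⊢
  obtain ⟨i1, i2, i3⟩ := incrementCmd_spec (s := s₁)
    (by rw [e 12 (by decide), h.act_eq]; exact hact)
    (by rw [e 12 (by decide), e 5 (by decide), h.act_eq]; exact h.bit)
  rw [e 12 (by decide), h.act_eq] at i1 i3
  rw [e 7 (by decide), e 5 (by decide), h.cells] at i3
  set s₂ := incrementCmd.sem s₁ with hs₂
  have e₂ : ∀ a, a ∉ incrementCmd.mods → s₂ a = s₁ a := fun a ha => sem_frame ha s₁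
  rw [sem_ite] at hready h7 h12 ⊢
  simp only [Expr.eval] at hready h7 h12 ⊢
  by_cases hc : s₂ 22 0 = 0
  · rw [branch_of_eq hc, sem_skip] at hready h7 h12 ⊢
    rw [hc, zero_mul, add_zero] at i3
    refine .inr ⟨⟨hready, by rw [h7, h.cells], by rw [h12, h.act_eq], i1, ?_, ?_⟩, i3⟩
    · rw [e₂ 17 (by decide), e 17 (by decide)]
      exact h.go
    · rw [i3]
      exact hfail
  · rw [branch_of_ne hc]
    have hc1 : s₂ 22 0 = 1 := by omega
    refine .inl ⟨by simp [sem_write, Store.set_apply, Expr.eval], .inr ⟨?_, ?_⟩⟩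
    · rw [sem_write, Store.set_of_ne (by decide), e₂ 3 (by decide)]
      exact not_not.1 hok
    · intro b hb
      refine hfail b hb ?_
      have := value_lt hact hb (n * n * n)
      rw [hc1, one_mul] at i3
      omega

theorem LoopInv.exec {n : ℕ} {G : SimpleGraph (Fin n)} {σ : Fin n ≃ Fin n} {t L : ℕ}
    {act : ℕ → ℕ} {s : Store} (h : LoopInv G σ t L act s) (hact : ∀ i, act i ≤ 1)
    (hact0 : ∀ i, n * n * n ≤ i → act i = 0) :
    ∃ s' T, Exec (.loop (var 17) bodyCmd.toProgram) s s' T ∧ LoopPost G σ t L act s' ∧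
      T ≤ 2 ^ rank act (n * n * n) * (bodyCmd.cost ((n + 2) ^ 3) + 3) + 3 := by
  -- Here `r` counts the contents not yet tested, the current one included. Each round costs the
  -- body and 3 for the guard; the last 3 pay for the guard that ends the loop.
  suffices H : ∀ r s, LoopInv G σ t L act s →
      value act (s 5) (n * n * n) + r = 2 ^ rank act (n * n * n) →
      ∃ s' T, Exec (.loop (var 17) bodyCmd.toProgram) s s' T ∧ LoopPost G σ t L act s' ∧
        T ≤ r * (bodyCmd.cost ((n + 2) ^ 3) + 3) + 3 by
    have hlt := value_lt hact h.bit (n * n * n)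
    obtain ⟨s', T, h1, h2, h3⟩ := H (2 ^ rank act (n * n * n) - value act (s 5) (n * n * n)) s h
      (by omega)
    exact ⟨s', T, h1, h2, h3.trans (by gcongr; omega)⟩
  clear h s
  intro r
  induction r with
  | zero =>
    intro s h hr
    have := value_lt hact h.bit (n * n * n)
    omega
  | succ r ih =>
    intro s h hr
    obtain ⟨T, hT, hexec⟩ := Cmd.exec bodyCmd_loopsOk (X := (n + 2) ^ 3) (s := s) fun b hb =>
      ⟨(bodyCmd_bounds b hb).1, h.bound b (bodyCmd_bounds b hb).2⟩
    have hgo : (var 17).eval s ≠ 0 := h.go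
    rcases h.step hact hact0 with ⟨h1, h2⟩ | ⟨h1, h2⟩
    · refine ⟨_, _, .loop_step hgo hexec (.loop_done h1), h2, ?_⟩
      simp only [Expr.cost, Nat.succ_mul]
      omega
    · obtain ⟨s', T', h3, h4, h5⟩ := ih _ h1 (by omega)
      refine ⟨s', _, .loop_step hgo hexec h3, h4, ?_⟩
      simp only [Expr.cost, Nat.succ_mul]
      omega

/-- Every path is described by the contents of the cells in use. -/
theorem Path.exists_describes {n : ℕ} {G : SimpleGraph (Fin n)} {σ : Fin n ≃ Fin n} {t L : ℕ}
    {Zs : List (Finset (Fin n))} {D : Finset (Finset (Fin n))}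
    (hP : Path G σ (depList G σ) t ∅ Zs D) (hL : Zs.length ≤ L) {act : ℕ → ℕ}
    (hact : ∀ l < L, ∀ v : Fin n, (∃ w, G.Adj v w) → act (l * n + v) = 1) :
    ∃ b : ℕ → ℕ, (∀ i, b i ≤ act i) ∧ Describes G σ t L b := by
  classical
  refine ⟨fun i => if ∃ l, ∃ hl : l < Zs.length, ∃ v ∈ Zs[l], i = l * n + (v : ℕ) then 1 else 0,
    fun i => ?_, Zs, D, hP, hL, fun k hk => ?_⟩
  · dsimp only
    split_ifs with h
    · obtain ⟨l, hl, v, hv, rfl⟩ := h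
      exact (hact l (hl.trans_le hL) v
        (hP.adj_of_mem (isDEP_depList G σ) _ (List.getElem_mem hl) v hv)).ge
    · exact Nat.zero_le _
  · ext v
    rw [mem_rowSet]
    rw [ne_eq, ite_eq_right_iff, Classical.not_imp]
    constructor
    · rintro ⟨⟨l, hl, w, hw, hlw⟩, -⟩
      have hn : 0 < n := v.pos
      have h1 : (k * n + v) / n = k := by
        rw [mul_comm, Nat.mul_add_div hn, Nat.div_eq_of_lt v.2, add_zero]
      have h2 : (l * n + w) / n = l := by
        rw [mul_comm, Nat.mul_add_div hn, Nat.div_eq_of_lt w.2, add_zero]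
      obtain rfl : k = l := by rw [← h1, hlw, h2]
      obtain rfl : v = w := Fin.ext (Nat.add_left_cancel hlw)
      exact hw
    · exact fun hv => ⟨⟨k, hk, v, hv, rfl⟩, one_ne_zero⟩

/-! ### The complete program -/

/-- The preprocessing. -/
def prepProgram : Program :=
  .seq squareCmd.toProgram (.seq multiplesCmd.toProgram (.seq rowsCmd.toProgram
    (.seq activeCmd.toProgram (.seq cellsCmd.toProgram orderCmd.toProgram))))

/-- The program that solves Assignment Clique Cover. -/
def accProgram : Program :=
  .seq prepProgram (.ite (.sub (var 10) (var 1)) .skip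
    (.seq (.write 17 (.const 0) (.const 1)) (.loop (var 17) bodyCmd.toProgram)))

-- The input, its non-isolated vertices and the cells in use

theorem input_of_two_lt {n : ℕ} (G : SimpleGraph (Fin n)) (t : ℕ) {a : ℕ} (ha : 2 < a) :
    input G t a = fun _ => 0 := by
  funext i
  simp [input, show a ≠ 0 by omega, show a ≠ 1 by omega, show a ≠ 2 by omega]

theorem input_adj {n : ℕ} (G : SimpleGraph (Fin n)) (t : ℕ) (u v : Fin n) :
    input G t 2 (u * n + v) ≠ 0 ↔ G.Adj u v := by
  have key : (∃ u' v' : Fin n, G.Adj u' v' ∧ (u : ℕ) * n + v = u'.val * n + v'.val) ↔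
      G.Adj u v := by
    constructor
    · rintro ⟨u', v', hadj, h⟩
      have hn : 0 < n := v.pos
      have h1 : ((u : ℕ) * n + v) / n = u := by
        rw [mul_comm, Nat.mul_add_div hn, Nat.div_eq_of_lt v.2, add_zero]
      have h2 : ((u' : ℕ) * n + v') / n = u' := by
        rw [mul_comm, Nat.mul_add_div hn, Nat.div_eq_of_lt v'.2, add_zero]
      obtain rfl : u = u' := Fin.ext (by rw [← h1, h, h2])
      obtain rfl : v = v' := Fin.ext (Nat.add_left_cancel h)
      exact hadj
    · exact fun h => ⟨u, v, h, rfl⟩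
  simp [input, key]

theorem activeVal_le_one (n : ℕ) (A : ℕ → ℕ) (v : ℕ) : activeVal n A v ≤ 1 := by
  unfold activeVal; split_ifs <;> simp

theorem activeVal_input {n : ℕ} (G : SimpleGraph (Fin n)) (t : ℕ) (v : Fin n)
    [Decidable (∃ w, G.Adj v w)] :
    activeVal n (input G t 2) v = if ∃ w, G.Adj v w then 1 else 0 := by
  have : ((v : ℕ) < n ∧ ∃ w < n, input G t 2 (v * n + w) ≠ 0) ↔ ∃ w, G.Adj v w := by
    constructor
    · rintro ⟨-, w, hw, h⟩
      exact ⟨⟨w, hw⟩, (input_adj G t v ⟨w, hw⟩).1 h⟩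
    · rintro ⟨w, h⟩
      exact ⟨v.2, w, w.2, (input_adj G t v w).2 h⟩
  simp only [activeVal, this]

theorem sum_activeVal_input {n : ℕ} (G : SimpleGraph (Fin n)) (t : ℕ) :
    ∑ v ∈ Finset.range n, activeVal n (input G t 2) v =
      {v : Fin n | ∃ w, G.Adj v w}.ncard := by
  classical
  rw [← Fin.sum_univ_eq_sum_range]
  simp only [activeVal_input]
  rw [Finset.sum_boole, Nat.cast_id, ← Set.ncard_coe_finset]
  simp

theorem sum_range_mul_eq {n : ℕ} (R : ℕ) (f : ℕ → ℕ) :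
    ∑ i ∈ Finset.range (R * n), f i =
      ∑ l ∈ Finset.range R, ∑ v ∈ Finset.range n, f (l * n + v) := by
  induction R with
  | zero => simp
  | succ R ih => rw [Nat.succ_mul, Finset.sum_range_add, ih, Finset.sum_range_succ]

/-- The number of rows in use. -/
abbrev rowBound (n t : ℕ) : ℕ := min (n * n) (t / 2)

/-- The indicator of the cells in use. -/
noncomputable def cellVal {n : ℕ} (G : SimpleGraph (Fin n)) (t i : ℕ) : ℕ :=
  if i / n < rowBound n t ∧ i % n < n then activeVal n (input G t 2) (i % n) else 0

theorem cellVal_apply {n : ℕ} (G : SimpleGraph (Fin n)) (t l : ℕ) {v : ℕ} (hv : v < n) :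
    cellVal G t (l * n + v) =
      if l < rowBound n t then activeVal n (input G t 2) v else 0 := by
  have hn : 0 < n := by omega
  have h1 : (l * n + v) / n = l := by
    rw [mul_comm, Nat.mul_add_div hn, Nat.div_eq_of_lt hv, add_zero]
  have h2 : (l * n + v) % n = v := by rw [mul_comm, Nat.mul_add_mod, Nat.mod_eq_of_lt hv]
  rw [cellVal, h1, h2]
  simp only [hv, and_true]

/-- This is the number of bits that the counter runs through, hence the exponent in the running
time: at most `t / 2` times the number of non-isolated vertices. -/
theorem rank_cellVal {n : ℕ} (G : SimpleGraph (Fin n)) (t : ℕ) :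
    rank (cellVal G t) (n * n * n) = rowBound n t * {v : Fin n | ∃ w, G.Adj v w}.ncard := by
  rw [rank, sum_range_mul_eq, ← sum_activeVal_input G t]
  have h1 : ∀ l, ∑ v ∈ Finset.range n, cellVal G t (l * n + v) =
      if l < rowBound n t then ∑ v ∈ Finset.range n, activeVal n (input G t 2) v else 0 := by
    intro l
    rw [Finset.sum_congr rfl fun v hv => cellVal_apply G t l (Finset.mem_range.1 hv)]
    split_ifs <;> simp
  simp only [h1]
  rw [← Finset.sum_filter, Finset.sum_const, smul_eq_mul]
  congr 1
  rw [show (Finset.range (n * n)).filter (fun l => l < rowBound n t) =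
    Finset.range (rowBound n t) by ext l; simp, Finset.card_range]

theorem cellVal_le_one {n : ℕ} (G : SimpleGraph (Fin n)) (t i : ℕ) : cellVal G t i ≤ 1 := by
  unfold cellVal
  split_ifs
  · exact activeVal_le_one _ _ _
  · exact Nat.zero_le _

theorem cellVal_eq_zero {n : ℕ} (G : SimpleGraph (Fin n)) (t i : ℕ) (hi : n * n * n ≤ i) :
    cellVal G t i = 0 := by
  rw [cellVal, if_neg]
  rintro ⟨h1, h2⟩
  have hn : 0 < n := by omega
  have h3 : n * n ≤ i / n := (Nat.le_div_iff_mul_le hn).2 hi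
  have h4 : rowBound n t ≤ n * n := min_le_left _ _
  omega

/-- The store after the preprocessing. -/
structure Prepared {n : ℕ} (G : SimpleGraph (Fin n)) (σ : Fin n ≃ Fin n) (t : ℕ) (s : Store) :
    Prop where
  ready : Ready G σ t (rowBound n t) s
  cells : s 7 0 = n * n * n
  act : s 12 = cellVal G t
  count : s 10 0 = {v : Fin n | ∃ w, G.Adj v w}.ncard
  ok : s 3 0 = 0
  row : ∀ i, s 5 i = 0

theorem squareCmd_loopsOk : squareCmd.LoopsOk := by simp [squareCmd, LoopsOk, mods]
theorem multiplesCmd_loopsOk : multiplesCmd.LoopsOk := by simp [multiplesCmd, LoopsOk, mods]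
theorem rowsCmd_loopsOk : rowsCmd.LoopsOk := by simp [rowsCmd, LoopsOk, mods]
theorem activeCmd_loopsOk : activeCmd.LoopsOk := by simp [activeCmd, LoopsOk, mods]
theorem cellsCmd_loopsOk : cellsCmd.LoopsOk := by simp [cellsCmd, LoopsOk, mods]
theorem orderCmd_loopsOk : orderCmd.LoopsOk := by
  simp [orderCmd, minDegreeCmd, degreeCmd, LoopsOk, mods]

/-- The exponent is fixed before `n`, `G` and `t`, because each phase consists of loops bounded by
`n` and `n * n` only. The ordering `σ` is read off from the arrays afterwards. -/
theorem exists_prepared : ∃ c, ∀ (n : ℕ) (G : SimpleGraph (Fin n)) (t : ℕ),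
    ∃ σ : Fin n ≃ Fin n, IsDegeneracyOrdering G σ ∧
      ∃ s T, Exec prepProgram (input G t) s T ∧ T ≤ (n + 2) ^ c ∧ Prepared G σ t s := by
  obtain ⟨c₁, hc₁⟩ := exists_cost_le squareCmd
  obtain ⟨c₂, hc₂⟩ := exists_cost_le multiplesCmd
  obtain ⟨c₃, hc₃⟩ := exists_cost_le rowsCmd
  obtain ⟨c₄, hc₄⟩ := exists_cost_le activeCmd
  obtain ⟨c₅, hc₅⟩ := exists_cost_le cellsCmd
  obtain ⟨c₆, hc₆⟩ := exists_cost_le orderCmd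
  refine ⟨c₁ + (c₂ + (c₃ + (c₄ + (c₅ + c₆ + 1) + 1) + 1) + 1) + 1, fun n G t => ?_⟩
  have hX1 : n ≤ (n + 2) ^ 3 := (Nat.le_add_right n 2).trans (Nat.le_self_pow (by omega) _)
  have hX2 : n * n ≤ (n + 2) ^ 3 := by
    calc n * n ≤ (n + 2) ^ 2 := by rw [← sq]; exact Nat.pow_le_pow_left (by omega) 2
      _ ≤ _ := Nat.pow_le_pow_right (by omega) (by omega)
  set s₀ := input G t with hs₀
  have i0 : s₀ 0 0 = n := by simp [hs₀, input]
  have i1 : s₀ 1 0 = t := by simp [hs₀, input]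
  have iz : ∀ a, 2 < a → ∀ i, s₀ a i = 0 := fun a ha i => by
    rw [hs₀, input_of_two_lt G t ha]
  set s₁ := squareCmd.sem s₀ with hs₁
  have e₁ : ∀ a, a ∉ [6, 20] → s₁ a = s₀ a := fun a ha =>
    sem_frame (p := squareCmd) (by revert ha; simp [squareCmd, mods]; tauto) s₀
  have h6 : s₁ 6 0 = n * n := by rw [hs₁, squareCmd_spec (iz 6 (by omega) 0), i0]
  set s₂ := multiplesCmd.sem s₁ with hs₂
  have e₂ : ∀ a, a ∉ [7, 8, 20] → s₂ a = s₁ a := fun a ha =>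
    sem_frame (p := multiplesCmd) (by revert ha; simp [multiplesCmd, mods]; tauto) s₁
  obtain ⟨h8, h7⟩ := multiplesCmd_spec (s := s₁) (by rw [e₁ 8 (by decide)]; exact iz 8 (by omega) 0)
  rw [← hs₂, h6, e₁ 0 (by decide), i0] at h8 h7
  set s₃ := rowsCmd.sem s₂ with hs₃
  have e₃ : ∀ a, a ∉ [11, 20] → s₃ a = s₂ a := fun a ha =>
    sem_frame (p := rowsCmd) (by revert ha; simp [rowsCmd, mods]; tauto) s₂
  have h11 : s₃ 11 0 = rowBound n t := by
    rw [hs₃, rowsCmd_spec (by rw [e₂ 11 (by decide), e₁ 11 (by decide)]; exact iz 11 (by omega) 0),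
      e₂ 6 (by decide), e₂ 1 (by decide), e₁ 1 (by decide), h6, i1]
  have e03 : ∀ a, a ∉ [6, 7, 8, 11, 20] → s₃ a = s₀ a := fun a ha => by
    simp only [List.mem_cons, List.not_mem_nil, or_false, not_or] at ha
    rw [e₃ a (by simp; tauto), e₂ a (by simp; tauto), e₁ a (by simp; tauto)]
  have h8' : ∀ l ≤ n * n, s₃ 8 l = l * n := fun l hl => by rw [e₃ 8 (by decide), h8 l hl]
  set s₄ := activeCmd.sem s₃ with hs₄
  have e₄ : ∀ a, a ∉ [9, 10, 20, 21] → s₄ a = s₃ a := fun a ha =>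
    sem_frame (p := activeCmd) (by revert ha; simp [activeCmd, mods]; tauto) s₃
  obtain ⟨h9, h10⟩ := activeCmd_spec (s := s₃)
    (fun v => by rw [e03 9 (by decide)]; exact iz 9 (by omega) v)
    (by rw [e03 10 (by decide)]; exact iz 10 (by omega) 0)
    (fun v hv => by
      rw [e03 0 (by decide), i0] at hv ⊢
      exact h8' v (hv.le.trans (Nat.le_mul_self n)))
  rw [← hs₄, e03 0 (by decide), e03 2 (by decide), i0] at h9 h10
  rw [sum_activeVal_input] at h10
  have e04 : ∀ a, a ∉ [6, 7, 8, 9, 10, 11, 20, 21] → s₄ a = s₀ a := fun a ha => by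
    simp only [List.mem_cons, List.not_mem_nil, or_false, not_or] at ha
    rw [e₄ a (by simp; tauto), e03 a (by simp; tauto)]
  set s₅ := cellsCmd.sem s₄ with hs₅
  have e₅ : ∀ a, a ∉ [12, 20, 21] → s₅ a = s₄ a := fun a ha =>
    sem_frame (p := cellsCmd) (by revert ha; simp [cellsCmd, mods]; tauto) s₄
  have h12 : ∀ i, s₅ 12 i = cellVal G t i := by
    intro i
    have := cellsCmd_spec (s := s₄) (fun i => by rw [e04 12 (by decide)]; exact iz 12 (by omega) i)
      (fun l hl => by
        rw [e₄ 11 (by decide), h11] at hl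
        rw [e04 0 (by decide), i0, e₄ 8 (by decide),
          h8' l (hl.le.trans (min_le_left _ _))]) i
    rw [e04 0 (by decide), i0, e₄ 11 (by decide), h11, h9] at this
    exact this
  have e05 : ∀ a, a ∉ [6, 7, 8, 9, 10, 11, 12, 20, 21] → s₅ a = s₀ a := fun a ha => by
    simp only [List.mem_cons, List.not_mem_nil, or_false, not_or] at ha
    rw [e₅ a (by simp; tauto), e04 a (by simp; tauto)]
  have e35 : ∀ a, a ∉ [9, 10, 12, 20, 21] → s₅ a = s₃ a := fun a ha => by
    simp only [List.mem_cons, List.not_mem_nil, or_false, not_or] at ha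
    rw [e₅ a (by simp; tauto), e₄ a (by simp; tauto)]
  set s₆ := orderCmd.sem s₅ with hs₆
  have e₆ : ∀ a, a ∉ [13, 14, 15, 20, 21, 22, 23, 24, 25] → s₆ a = s₅ a := fun a ha =>
    sem_frame (p := orderCmd)
      (by revert ha; simp [orderCmd, minDegreeCmd, degreeCmd, mods]; tauto) s₅
  have hel := orderCmd_spec (s := s₅)
    (fun v hv => by
      rw [e05 0 (by decide), i0] at hv ⊢
      rw [e35 8 (by decide), h8' v (hv.le.trans (Nat.le_mul_self n))])
    (fun v => by rw [e05 13 (by decide)]; exact iz 13 (by omega) v)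
  rw [← hs₆, e05 0 (by decide), e05 2 (by decide), i0] at hel
  obtain ⟨σ, hσ, hord, hpos⟩ := hel.exists_ordering (G := G) (input_adj G t)
  refine ⟨σ, hσ, s₆, ?_⟩
  have hprep : Prepared G σ t s₆ := by
    refine ⟨⟨?_, ?_, ?_, ?_, ?_, min_le_left _ _, hord, hpos⟩, ?_, ?_, ?_, ?_, ?_⟩
    · rw [e₆ 0 (by decide), e05 0 (by decide), i0]
    · rw [e₆ 1 (by decide), e05 1 (by decide), i1]
    · rw [e₆ 2 (by decide), e05 2 (by decide)]; exact input_adj G t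
    · rw [e₆ 8 (by decide), e35 8 (by decide)]; exact h8'
    · rw [e₆ 11 (by decide), e35 11 (by decide), h11]
    · rw [e₆ 7 (by decide), e35 7 (by decide), e₃ 7 (by decide), h7]
    · rw [e₆ 12 (by decide)]; exact funext h12
    · rw [e₆ 10 (by decide), e₅ 10 (by decide), h10]
    · rw [e₆ 3 (by decide), e05 3 (by decide)]; exact iz 3 (by omega) 0
    · rw [e₆ 5 (by decide), e05 5 (by decide)]; exact iz 5 (by omega)
  obtain ⟨T₁, l₁, x₁⟩ := exec squareCmd_loopsOk (X := (n + 2) ^ 3) (s := s₀) (by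
    simpa [squareCmd, bounds, mods, i0] using hX1)
  obtain ⟨T₂, l₂, x₂⟩ := exec multiplesCmd_loopsOk (X := (n + 2) ^ 3) (s := s₁) (by
    simpa [multiplesCmd, bounds, mods, h6] using hX2)
  obtain ⟨T₃, l₃, x₃⟩ := exec rowsCmd_loopsOk (X := (n + 2) ^ 3) (s := s₂) (by
    simpa [rowsCmd, bounds, mods, e₂, h6] using hX2)
  obtain ⟨T₄, l₄, x₄⟩ := exec activeCmd_loopsOk (X := (n + 2) ^ 3) (s := s₃) (by
    simpa [activeCmd, bounds, mods, e03, i0] using hX1)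
  obtain ⟨T₅, l₅, x₅⟩ := exec cellsCmd_loopsOk (X := (n + 2) ^ 3) (s := s₄) (by
    have h1 : rowBound n t ≤ (n + 2) ^ 3 := (min_le_left _ _).trans hX2
    intro b hb
    simp only [cellsCmd, bounds, List.mem_cons, List.not_mem_nil, or_false] at hb
    rcases hb with rfl | rfl
    · exact ⟨by decide, by rw [e₄ 11 (by decide), h11]; exact h1⟩
    · exact ⟨by decide, by rw [e04 0 (by decide), i0]; exact hX1⟩)
  obtain ⟨T₆, l₆, x₆⟩ := exec orderCmd_loopsOk (X := (n + 2) ^ 3) (s := s₅) (by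
    simpa [orderCmd, minDegreeCmd, degreeCmd, bounds, mods, e05, i0] using hX1)
  refine ⟨_, .seq x₁ (.seq x₂ (.seq x₃ (.seq x₄ (.seq x₅ x₆)))), ?_, hprep⟩
  exact add_le_pow (l₁.trans (hc₁ n)) (add_le_pow (l₂.trans (hc₂ n)) (add_le_pow
    (l₃.trans (hc₃ n)) (add_le_pow (l₄.trans (hc₄ n)) (add_le_pow (l₅.trans (hc₅ n))
      (l₆.trans (hc₆ n))))))

/-- If no contents of the cells in use describe a path, then the search fails. -/
theorem accs_eq_none {n : ℕ} {G : SimpleGraph (Fin n)} {σ : Fin n ≃ Fin n} {t : ℕ}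
    {cl : Fin n → Fin n → List (Finset (Fin n))} (hcl : EnumeratesCliques G σ cl)
    (h : ∀ b : ℕ → ℕ, (∀ i, b i ≤ cellVal G t i) → ¬ Describes G σ t (rowBound n t) b) :
    (accs (depList G σ) cl t ∅).result = none := by
  classical
  rcases hr : (accs (depList G σ) cl t ∅).result with _ | D
  · rfl
  obtain ⟨Zs, hP⟩ := exists_path_of_accs (isDEP_depList G σ) hcl hr
  -- Both bounds on the length of a path are needed, since the rows provided are the minimum of `n *
  -- n` and `t / 2`.
  have h1 := hP.two_mul_length_le (isDEP_depList G σ)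
  have h2 : Zs.length ≤ n * n := by
    refine hP.length_le.trans ((Finset.card_filter_le _ _).trans ?_)
    simp
  obtain ⟨b, hb, hd⟩ := hP.exists_describes (L := rowBound n t) (le_min h2 (by omega))
    (act := cellVal G t) (fun l hl v hv => by
      rw [cellVal_apply G t l v.2, if_pos hl, activeVal_input, if_pos hv])
  exact absurd hd (h b hb)

theorem accProgram_spec : ∃ c, ∀ (n : ℕ) (G : SimpleGraph (Fin n)) (t : ℕ),
    ∃ s T, Exec accProgram (input G t) s T ∧
      (T : ℝ) ≤ (1.4143 : ℝ) ^ (t ^ 2) * ((n : ℝ) + 2) ^ c ∧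
      ∃ (σ : Fin n ≃ Fin n) (cl : Fin n → Fin n → List (Finset (Fin n))),
        IsDegeneracyOrdering G σ ∧ EnumeratesCliques G σ cl ∧
        output n s = (accs (depList G σ) cl t ∅).result := by
  obtain ⟨c, hc⟩ := exists_prepared
  obtain ⟨d, hd⟩ := exists_cost_le bodyCmd
  refine ⟨c + (d + 20 + 1) + 1, fun n G t => ?_⟩
  -- `k` stands for the number of bits of the counter; the 10 is room for the test on the number of
  -- non-isolated vertices and for setting the loop flag.
  have htime : ∀ T k : ℕ, 2 * k ≤ t ^ 2 →
      T ≤ (n + 2) ^ c + 10 + 2 ^ k * (bodyCmd.cost ((n + 2) ^ 3) + 3) + 3 →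
      (T : ℝ) ≤ (1.4143 : ℝ) ^ (t ^ 2) * ((n : ℝ) + 2) ^ (c + (d + 20 + 1) + 1) := by
    intro T k hk hT
    have h1 : (n + 2) ^ c + (bodyCmd.cost ((n + 2) ^ 3) + 20) ≤
        (n + 2) ^ (c + (d + 20 + 1) + 1) :=
      add_le_pow le_rfl (add_le_pow (hd n) (const_le_pow n 20))
    have h2 : 1 ≤ 2 ^ k := Nat.one_le_two_pow
    have h3 : T ≤ 2 ^ k * (n + 2) ^ (c + (d + 20 + 1) + 1) := by
      refine le_trans ?_ (Nat.mul_le_mul_left _ h1)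
      have h4 := Nat.mul_le_mul_right ((n + 2) ^ c) h2
      generalize (n + 2) ^ c = A at *
      generalize bodyCmd.cost ((n + 2) ^ 3) = D at *
      generalize 2 ^ k = K at *
      rw [mul_add, mul_add]
      rw [mul_add] at hT
      omega
    calc (T : ℝ) ≤ ((2 ^ k * (n + 2) ^ (c + (d + 20 + 1) + 1) : ℕ) : ℝ) := by exact_mod_cast h3
      _ = ((2 ^ k : ℕ) : ℝ) * ((n : ℝ) + 2) ^ (c + (d + 20 + 1) + 1) := by push_cast; rfl
      _ ≤ _ := mul_le_mul_of_nonneg_right (two_pow_le_of_two_mul_le hk)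
          (pow_nonneg (add_nonneg n.cast_nonneg zero_le_two) _)
  obtain ⟨σ, hσ, s₁, T₁, x₁, hT₁, hs₁⟩ := hc n G t
  -- An enumeration without preferences, used whenever the output is NO: the search then fails in
  -- any order.
  obtain ⟨cl₀, hcl₀, -⟩ := exists_enumeratesCliques G σ (fun _ _ => none) (by simp)
  by_cases hm : s₁ 10 0 - s₁ 1 0 = 0
  · have hm' : {v : Fin n | ∃ w, G.Adj v w}.ncard ≤ t := by
      rw [← hs₁.count, ← hs₁.ready.budget]; omega
    set s₂ := s₁.set 17 0 1 with hs₂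
    have e₂ : ∀ a, a ≠ 17 → s₂ a = s₁ a := fun a ha => Store.set_of_ne ha
    have hinv : LoopInv G σ t (rowBound n t) (cellVal G t) s₂ := by
      refine ⟨hs₁.ready.congr fun a ha => e₂ a (by rintro rfl; revert ha; decide), ?_, ?_, ?_,
        ?_, ?_⟩
      · rw [e₂ 7 (by decide)]; exact hs₁.cells
      · rw [e₂ 12 (by decide)]; exact hs₁.act
      · intro i; rw [e₂ 5 (by decide), hs₁.row]; exact Nat.zero_le _
      · simp [hs₂, Store.set_apply]
      -- The counter starts at 0, so no contents have a smaller value.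
      · intro b _ hlt
        rw [e₂ 5 (by decide)] at hlt
        simp [value, hs₁.row] at hlt
    obtain ⟨s₃, T₃, x₃, hpost, hT₃⟩ := hinv.exec (cellVal_le_one G t) (cellVal_eq_zero G t)
    refine ⟨s₃, _, .seq x₁ (.ite_false hm (.seq (.write 17 (.const 0) (.const 1) s₁) x₃)),
      htime _ (rank (cellVal G t) (n * n * n)) ?_ ?_, σ, ?_⟩
    · rw [rank_cellVal]
      have h1 : 2 * rowBound n t ≤ t := by
        have : rowBound n t ≤ t / 2 := min_le_right _ _
        omega
      calc 2 * (rowBound n t * {v : Fin n | ∃ w, G.Adj v w}.ncard)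
          = (2 * rowBound n t) * {v : Fin n | ∃ w, G.Adj v w}.ncard := by ring
        _ ≤ t * t := Nat.mul_le_mul h1 hm'
        _ = t ^ 2 := (sq t).symm
    · simp only [Expr.cost]
      omega
    · rcases hpost with ⟨hok, Zs, hP⟩ | ⟨hok, hno⟩
      -- The order of enumeration is chosen after the run, to make the search follow the path that
      -- was found.
      · obtain ⟨cl, hcl, hr⟩ := hP.exists_enumeratesCliques (isDEP_depList G σ)
        refine ⟨cl, hσ, hcl, ?_⟩
        rw [hr, output, if_neg hok]
        rfl
      · refine ⟨cl₀, hσ, hcl₀, ?_⟩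
        rw [output, if_pos hok, accs_eq_none hcl₀ hno]
  · refine ⟨s₁, _, .seq x₁ (.ite_true hm (.skip s₁)), htime _ 0 (by omega) ?_, σ, cl₀, hσ, hcl₀,
      ?_⟩
    · simp only [Expr.cost]
      omega
    · rw [output, if_pos hs₁.ok]
      -- More than `t` vertices are non-isolated. Success of the search would yield a solution,
      -- contradicting `IsSolution.ncard_le`.
      have hans := accs_isAnswer (isDEP_depList G σ) hcl₀ t
      rcases hr : (accs (depList G σ) cl₀ t ∅).result with _ | D
      · rfl
      · rw [hr] at hans
        have hle := IsSolution.ncard_le hans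
        rw [← hs₁.count, ← hs₁.ready.budget] at hle
        exact absurd (Nat.sub_eq_zero_of_le hle) hm

end ACC

theorem mainTheorem5 :
    -- a program that solves the problem within the time bound, with the search's output
    (∃ (P : ACC.Program) (c : ℕ), ∀ (n : ℕ) (G : SimpleGraph (Fin n)) (t : ℕ),
      ∃ (s : ACC.Store) (T : ℕ),
        ACC.Exec P (ACC.input G t) s T ∧
        (T : ℝ) ≤ (1.4143 : ℝ) ^ (t ^ 2) * ((n : ℝ) + 2) ^ c ∧
        ACC.IsAnswer G t (ACC.output n s) ∧
        ∃ (σ : Fin n ≃ Fin n) (π : List (Fin n × Fin n))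
          (cl : Fin n → Fin n → List (Finset (Fin n))),
          ACC.IsDegeneracyOrdering G σ ∧ ACC.IsDEP G σ π ∧ ACC.EnumeratesCliques G σ cl ∧
          ACC.output n s = (ACC.accs π cl t ∅).result) ∧
    -- the search itself: correctness, depth, and size of its search tree
    (∀ (n : ℕ) (G : SimpleGraph (Fin n)) (t : ℕ) (σ : Fin n ≃ Fin n)
      (π : List (Fin n × Fin n)) (cl : Fin n → Fin n → List (Finset (Fin n))),
      ACC.IsDegeneracyOrdering G σ → ACC.IsDEP G σ π → ACC.EnumeratesCliques G σ cl →
        ACC.IsAnswer G t (ACC.accs π cl t ∅).result ∧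
        ((ACC.accs π cl t ∅).depth : ℝ) ≤ (t : ℝ) / 2 ∧
        ({v : Fin n | ∃ w, G.Adj v w}.ncard ≤ t →
          ((ACC.accs π cl t ∅).nodes : ℝ) ≤ (1.4143 : ℝ) ^ (t ^ 2))) := by
  constructor
  · obtain ⟨c, hc⟩ := ACC.accProgram_spec
    refine ⟨ACC.accProgram, c, fun n G t => ?_⟩
    obtain ⟨s, T, hex, hT, σ, cl, hσ, hcl, hout⟩ := hc n G t
    have hdep := ACC.isDEP_depList G σ
    refine ⟨s, T, hex, hT, ?_, σ, ACC.depList G σ, cl, hσ, hdep, hcl, hout⟩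
    rw [hout]
    exact ACC.accs_isAnswer hdep hcl t
  · intro n G t σ π cl _ hπ hcl
    refine ⟨ACC.accs_isAnswer hπ hcl t, ?_, ACC.accs_nodes_le_rpow hπ hcl⟩
    have h : ((2 * (ACC.accs π cl t ∅).depth : ℕ) : ℝ) ≤ t := by
      exact_mod_cast ACC.two_mul_accs_depth_le hπ hcl t ∅
    push_cast at h
    linarith
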